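/- For an integer $N\ge 1$, a $3$-tensor $T$ of dimensions $N^2\times N^2\times N^2$ is an array of complex numbers $T_{(i,i'),(j,j'),(k,k')}$ with $i,i',j,j',k,k'\in\{1,\dots,N\}$. Define $$\|T\|_{3,3}=\max_{x,y}\Big|\sum_{i,j,k,i',j',k'}T_{(i,i'),(j,j'),(k,k')}\,x_{ijk}\,y_{i'j'k'}\Big|,\qquad \|T\|_{2,2,2}=\max_{X,Y,Z}\Big|\sum_{i,j,k,i',j',k'}T_{(i,i'),(j,j'),(k,k')}\,X_{ii'}Y_{jj'}Z_{kk'}\Big|,$$ where $x,y$ range over the Euclidean unit sphere of $\mathbb C^{N^3}$ and $X,Y,Z$ over the Hermitian $N\times N$ complex matrices of Frobenius norm at most $1$. For a real vector $g=(g_{ijk})_{1\le i,j,k\le N}$ let $T_g$ be the tensor whose $(i,i'),(j,j'),(k,k')$ entry is $g_{ijk}\,g_{i'j'k'}$ if $i\ne i'$, $j\ne j'$ and $k\ne k'$, and $0$ otherwise. 1. There is a constant $C>0$ such that for every integer $N\ge 2$ there is a $3$-tensor $T$ of dimensions $N^2\times N^2\times N^2$, of the form $T=T_g$, with $$\frac{\|T\|_{3,3}}{\|T\|_{2,2,2}}\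 \ge\ C\,N^2\,(\log N)^{-5/2}.$$ Moreover, let the entries $g_{ijk}$ be independent standard normal random variables. 2. There is a constant $c>0$ such that for every $\delta\in(0,1)$ and all sufficiently large $N$ (depending on $\delta$), $(1-\delta)N^3\le\|T_g\|_{3,3}\le(1+\delta)N^3$ with probability at least $1-e^{-c\delta^2N^2}$. 3. There are constants $d,D>0$ such that for all sufficiently large $N$, $\|T_g\|_{2,2,2}\le D\,N(\log N)^{5/2}$ with probability at least $1-e^{-dN}$. -/

import Mathlib

open scoped BigOperators

/-- Complex `3`-tensors of dimensions `N² × N² × N²`, each of the three indices being a pair in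
`[N]²`: the entry `T (i, i') (j, j') (k, k')`. -/
abbrev PairTensor (N : ℕ) : Type :=
  Fin N × Fin N → Fin N × Fin N → Fin N × Fin N → ℂ

/-- The index set `[N]³`. -/
abbrev Triple (N : ℕ) : Type := Fin N × Fin N × Fin N

namespace PairTensor

noncomputable section

/-- The bilinear form on `ℂ^{N³}` given by the `N³ × N³` matrix with rows `(i, j, k)` and columns
`(i', j', k')`. -/
def bilin {N : ℕ} (T : PairTensor N) (x y : EuclideanSpace ℂ (Triple N)) : ℂ :=
  ∑ p : Triple N, ∑ q : Triple N,
    T (p.1, q.1) (p.2.1, q.2.1) (p.2.2, q.2.2) * x p * y q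

/-- The trilinear form `(X, Y, Z) ↦ ⟨T, X ⊗ Y ⊗ Z⟩` on `N × N` matrices. -/
def trilin {N : ℕ} (T : PairTensor N) (X Y Z : Matrix (Fin N) (Fin N) ℂ) : ℂ :=
  ∑ p : Triple N, ∑ q : Triple N,
    T (p.1, q.1) (p.2.1, q.2.1) (p.2.2, q.2.2) * X p.1 q.1 * Y p.2.1 q.2.1 * Z p.2.2 q.2.2

/-- `‖T‖_{3,3}`: the maximum of the modulus of the bilinear form over pairs of unit vectors of
`ℂ^{N³}` (Euclidean norm). -/
def norm33 {N : ℕ} (T : PairTensor N) : ℝ :=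
  sSup {r : ℝ | ∃ x y : EuclideanSpace ℂ (Triple N), ‖x‖ = 1 ∧ ‖y‖ = 1 ∧ r = ‖T.bilin x y‖}

open scoped Matrix.Norms.Frobenius in
/-- The unit ball, for the Frobenius norm, of the space of Hermitian `N × N` matrices. -/
def hermBall (N : ℕ) : Set (Matrix (Fin N) (Fin N) ℂ) :=
  {X | X.IsHermitian ∧ ‖X‖ ≤ 1}

/-- `‖T‖_{2,2,2}`: the maximum of the modulus of the trilinear form over triples of Hermitian
matrices of Frobenius norm at most one. -/
def norm222 {N : ℕ} (T : PairTensor N) : ℝ :=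
  sSup {r : ℝ | ∃ X ∈ hermBall N, ∃ Y ∈ hermBall N, ∃ Z ∈ hermBall N, r = ‖T.trilin X Y Z‖}

/-- The tensor with entries `g_{ijk} g_{i'j'k'}` if `i ≠ i'`, `j ≠ j'` and `k ≠ k'`, and `0`
otherwise. -/
def ofVector {N : ℕ} (g : Triple N → ℝ) : PairTensor N := fun a b c =>
  if a.1 ≠ a.2 ∧ b.1 ≠ b.2 ∧ c.1 ≠ c.2 then
    ((g (a.1, b.1, c.1) * g (a.2, b.2, c.2) : ℝ) : ℂ)
  else 0

/-- The law of a vector `(g_{ijk})` in `ℝ^{N³}` with i.i.d. standard normal entries. -/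
def gaussianLaw (N : ℕ) : MeasureTheory.Measure (Triple N → ℝ) :=
  MeasureTheory.Measure.pi fun _ => ProbabilityTheory.gaussianReal 0 1

end

end PairTensor

open scoped BigOperators

open MeasureTheory ProbabilityTheory Matrix WithLp
open scoped Kronecker

/-! The two norms separate because the bilinear norm sees that `T_g` is almost the rank-one matrix
`g gᵀ`, while the trilinear norm only tests it against product matrices.

Bilinear norm. The matrix `g gᵀ` has norm `‖g‖² ≈ N³`. Deleting the entries whose row and column
share a coordinate changes it by at most three block-diagonal matrices, whose blocks are rank one
with norm the squared length of a slice of `g`, which is `O(N²)`. Hence `norm33` is `‖g‖² + O(N²)`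
(`norm_bilin_sub_le`), and chi-square tails finish.

Trilinear norm. By `trilin_ofVector` the form is `gᵀ (X ⊗ Y ⊗ Z) g` with the diagonals of `X, Y, Z`
removed, a trace-zero Gaussian chaos. A Hermitian matrix of Frobenius norm at most one splits
dyadically into `O(log N)` multiples of flat matrices (rank `r`, operator norm at most `1/√r`) with
square-summable coefficients (`exists_flat_decomposition`). Cauchy–Schwarz costs `√log N` for each
of the three factors, so a bound `O(N log N)` on flat triples gives the power `5/2` of the
logarithm.

For flat matrices of ranks `r, s, t` there are two regimes. If each rank is at most the product of
the other two, then `m = max r s t` satisfies `m² ≤ rst`. A net of flat triples has `exp(O(m N log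
N))` points, and the chaos, of Frobenius norm at most `1` and operator norm at most `8/√(rst)`, has
a tail with exponential rate of order `m`; at height `N log N` it beats the net
(`stdNormalLaw_flat_net_tail`). Otherwise, say `st ≤ r`; the trace norms of `Y` and `Z` are at most
`√s` and `√t`, so rank-one expansion bounds the form by the squared injective norm of `g` times
`√(st/r) ≤ 1`, up to a constant (`norm_quadForm₃_flat_le_of_mul_le`). That squared norm is `O(N log
N)` by another net (`stdNormalLaw_not_injLe`). -/

theorem one_le_one_sub_mul_exp {x : ℝ} (hx : x ≤ 1 / 2) : 1 ≤ (1 - x) * Real.exp (x + x ^ 2) := by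
  rcases le_total 0 x with h | h
  · have h1 := Real.quadratic_le_exp_of_nonneg (x := x + x ^ 2) (by positivity)
    have h2 : 1 ≤ (1 - x) * (1 + (x + x ^ 2) + (x + x ^ 2) ^ 2 / 2) := by
      have h3 : 0 ≤ x ^ 2 * ((1 - x) * (1 + x) ^ 2 / 2 - x) := by
        apply mul_nonneg (sq_nonneg x)
        nlinarith [mul_nonneg h h, mul_nonneg h (sub_nonneg.2 hx), mul_nonneg (mul_nonneg h h) (sub_nonneg.2 hx)]
      nlinarith
    exact h2.trans (mul_le_mul_of_nonneg_left h1 (by linarith))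
  · have h1 := Real.add_one_le_exp (x + x ^ 2)
    have h2 : 1 ≤ (1 - x) * (x + x ^ 2 + 1) := by nlinarith [mul_nonneg (sq_nonneg x) (neg_nonneg.2 h)]
    exact h2.trans (mul_le_mul_of_nonneg_left h1 (by linarith))

/-- The integral equals `(1 - 2s)^(-1/2)`; `one_le_one_sub_mul_exp` at `x = 2s` turns it into an
exponential whose second term is quadratic in `s`, valid for negative `s` too. -/
theorem gaussianReal_exp_mul_sq {s : ℝ} (hs : s ≤ 1 / 4) :
    Integrable (fun x : ℝ => Real.exp (s * x ^ 2)) (gaussianReal 0 1) ∧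
      ∫ x, Real.exp (s * x ^ 2) ∂(gaussianReal 0 1) ≤ Real.exp (s + 2 * s ^ 2) := by
  have hb : 0 < 1 / 2 - s := by linarith
  have key : ∀ x : ℝ, gaussianPDFReal 0 1 x * Real.exp (s * x ^ 2)
      = (√(2 * Real.pi))⁻¹ * Real.exp (-(1 / 2 - s) * x ^ 2) := by
    intro x
    simp only [gaussianPDFReal, NNReal.coe_one, mul_one, sub_zero]
    rw [mul_assoc, ← Real.exp_add]
    congr 2
    ring
  constructor
  · rw [gaussianReal_of_var_ne_zero _ one_ne_zero,
      integrable_withDensity_iff_integrable_smul₀' (by fun_prop) (by simp [gaussianPDF])]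
    simp only [toReal_gaussianPDF, smul_eq_mul, key]
    exact (integrable_exp_neg_mul_sq hb).const_mul _
  · rw [integral_gaussianReal_eq_integral_smul one_ne_zero]
    simp only [smul_eq_mul, key]
    rw [integral_const_mul, integral_gaussian, ← Real.sqrt_inv, ← Real.sqrt_mul (by positivity)]
    apply Real.sqrt_le_iff.2
    refine ⟨(Real.exp_pos _).le, ?_⟩
    have h1 := one_le_one_sub_mul_exp (x := 2 * s) (by linarith)
    have h2 : Real.exp (s + 2 * s ^ 2) ^ 2 = Real.exp (2 * s + (2 * s) ^ 2) := by
      rw [← Real.exp_nat_mul]; congr 1; push_cast; ring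
    rw [h2]
    have h3 : (2 * Real.pi)⁻¹ * (Real.pi / (1 / 2 - s)) = 1 / (1 - 2 * s) := by
      have := Real.pi_pos.ne'
      have h4 : 1 - 2 * s ≠ 0 := by linarith
      have : 1 / 2 - s ≠ 0 := hb.ne'
      have h5 : (1 / 2 - s) = (1 - 2 * s) / 2 := by ring
      rw [h5]
      field_simp
    rw [h3, div_le_iff₀ (by linarith)]
    linarith

/-! ### Exponential tails of real Gaussian quadratic forms. -/

section Chaos

variable {ι : Type*} [Fintype ι]

/-- The law of a family of independent standard Gaussians. -/
noncomputable abbrev stdNormalLaw (ι : Type*) [Fintype ι] : Measure (ι → ℝ) :=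
  Measure.pi fun _ => gaussianReal 0 1

theorem stdNormalLaw_exp_diag (m : ι → ℝ) {s : ℝ} (hs : ∀ i, s * m i ≤ 1 / 4) :
    Integrable (fun x : ι → ℝ => Real.exp (s * ∑ i, m i * x i ^ 2)) (stdNormalLaw ι) ∧
      ∫ x, Real.exp (s * ∑ i, m i * x i ^ 2) ∂(stdNormalLaw ι)
        ≤ Real.exp (s * ∑ i, m i + 2 * s ^ 2 * ∑ i, m i ^ 2) := by
  have key : (fun x : ι → ℝ => Real.exp (s * ∑ i, m i * x i ^ 2))
      = fun x => ∏ i, (fun y : ℝ => Real.exp ((s * m i) * y ^ 2)) (x i) := by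
    funext x
    rw [← Real.exp_sum, Finset.mul_sum]
    simp only [mul_assoc]
  rw [key]
  constructor
  · exact Integrable.fintype_prod (f := fun i (y : ℝ) => Real.exp ((s * m i) * y ^ 2))
      fun i => (gaussianReal_exp_mul_sq (hs i)).1
  · rw [integral_fintype_prod_eq_prod (fun i (y : ℝ) => Real.exp ((s * m i) * y ^ 2))]
    have h : s * ∑ i, m i + 2 * s ^ 2 * ∑ i, m i ^ 2
        = ∑ i, (s * m i + 2 * (s * m i) ^ 2) := by
      rw [Finset.sum_add_distrib, Finset.mul_sum, Finset.mul_sum]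
      congr 1
      exact Finset.sum_congr rfl fun i _ => by ring
    rw [h, Real.exp_sum]
    exact Finset.prod_le_prod (fun i _ => integral_nonneg fun _ => (Real.exp_pos _).le)
      fun i _ => (gaussianReal_exp_mul_sq (hs i)).2

theorem stdNormalLaw_real_rotate (b : OrthonormalBasis ι ℝ (EuclideanSpace ℝ ι))
    {S : Set (ι → ℝ)} (hS : MeasurableSet S) :
    (stdNormalLaw ι).real S = (stdNormalLaw ι).real {x | ofLp (∑ i, x i • b i) ∈ S} := by
  have hmap : (stdNormalLaw ι).map (toLp 2)
      = (stdNormalLaw ι).map (fun x => ∑ i, x i • b i) := by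
    rw [map_pi_eq_stdGaussian, stdGaussian_eq_map_pi_orthonormalBasis b]
  have h2 : MeasurableSet (ofLp ⁻¹' S : Set (EuclideanSpace ℝ ι)) :=
    hS.preimage (by fun_prop)
  have h3 : (stdNormalLaw ι).map (toLp 2) (ofLp ⁻¹' S)
      = (stdNormalLaw ι).map (fun x => ∑ i, x i • b i) (ofLp ⁻¹' S) := by rw [hmap]
  rw [Measure.map_apply (by fun_prop) h2, Measure.map_apply (by fun_prop) h2] at h3
  rw [measureReal_def, measureReal_def]
  exact congrArg ENNReal.toReal h3

variable [DecidableEq ι]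

theorem Matrix.IsHermitian.quadForm_eq {A : Matrix ι ι ℝ} (hA : A.IsHermitian) (x : ι → ℝ) :
    ofLp (∑ i, x i • hA.eigenvectorBasis i) ⬝ᵥ A *ᵥ ofLp (∑ i, x i • hA.eigenvectorBasis i)
      = ∑ i, hA.eigenvalues i * x i ^ 2 := by
  have h1 : A *ᵥ ofLp (∑ i, x i • hA.eigenvectorBasis i)
      = ofLp (∑ i, (hA.eigenvalues i * x i) • hA.eigenvectorBasis i) := by
    simp only [WithLp.ofLp_sum, WithLp.ofLp_smul, Matrix.mulVec_sum, Matrix.mulVec_smul,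
      hA.mulVec_eigenvectorBasis, smul_smul]
    exact Finset.sum_congr rfl fun i _ => by rw [mul_comm]
  have h2 : ∀ v w : EuclideanSpace ℝ ι, ofLp v ⬝ᵥ ofLp w = inner ℝ v w := by
    intro v w
    simp [PiLp.inner_apply, dotProduct, mul_comm]
  rw [h1, h2, hA.eigenvectorBasis.orthonormal.inner_sum]
  exact Finset.sum_congr rfl fun i _ => by simp; ring

/-- `A` sends the `i`-th eigenvector to a vector of length `|λᵢ|`; summing over `i` and applying
Parseval to each row of `A` gives the Frobenius norm. -/
theorem Matrix.IsHermitian.sum_eigenvalues_sq {A : Matrix ι ι ℝ} (hA : A.IsHermitian) :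
    ∑ i, hA.eigenvalues i ^ 2 = ∑ i, ∑ j, A i j ^ 2 := by
  have h1 : ∀ i, ∑ j, (A *ᵥ ⇑(hA.eigenvectorBasis i)) j ^ 2 = hA.eigenvalues i ^ 2 := by
    intro i
    rw [hA.mulVec_eigenvectorBasis]
    simp only [Pi.smul_apply, smul_eq_mul, mul_pow, ← Finset.mul_sum]
    have := hA.eigenvectorBasis.orthonormal.1 i
    rw [EuclideanSpace.norm_eq, Real.sqrt_eq_one] at this
    simp only [Real.norm_eq_abs, sq_abs] at this
    rw [this, mul_one]
  simp only [← h1]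
  rw [Finset.sum_comm]
  refine Finset.sum_congr rfl fun j _ => ?_
  have h3 := hA.eigenvectorBasis.sum_sq_norm_inner_right (toLp 2 (A j))
  rw [EuclideanSpace.norm_sq_eq] at h3
  simp only [Real.norm_eq_abs, sq_abs] at h3
  rw [← h3]
  refine Finset.sum_congr rfl fun i _ => ?_
  simp [PiLp.inner_apply, Matrix.mulVec, dotProduct]

/-- Exponential tail of a real Gaussian quadratic form. -/
theorem stdNormalLaw_quadForm_tail {A : Matrix ι ι ℝ} (hA : A.IsHermitian) {a s : ℝ}
    (hop : ∀ v : ι → ℝ, v ⬝ᵥ A *ᵥ v ≤ a * ∑ i, v i ^ 2) (hs : 0 ≤ s) (hsa : 4 * a * s ≤ 1)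
    (t : ℝ) :
    (stdNormalLaw ι).real {g | t ≤ g ⬝ᵥ A *ᵥ g}
      ≤ Real.exp (-(s * t) + s * A.trace + 2 * s ^ 2 * ∑ i, ∑ j, A i j ^ 2) := by
  have heig : ∀ i, hA.eigenvalues i ≤ a := by
    intro i
    have h := hop (ofLp (hA.eigenvectorBasis i))
    rw [hA.mulVec_eigenvectorBasis] at h
    have h1 := hA.eigenvectorBasis.orthonormal.1 i
    rw [EuclideanSpace.norm_eq, Real.sqrt_eq_one] at h1
    simp only [Real.norm_eq_abs, sq_abs] at h1
    rw [h1, dotProduct_smul, dotProduct] at h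
    simp only [← pow_two, h1, smul_eq_mul, mul_one] at h
    exact h
  -- After rotating to the eigenbasis the form is diagonal; `4as ≤ 1` is exactly what keeps every
  -- one-dimensional Laplace transform in its admissible range.
  have hse : ∀ i, s * hA.eigenvalues i ≤ 1 / 4 := fun i => by
    nlinarith [mul_le_mul_of_nonneg_left (heig i) hs]
  obtain ⟨hint, hle⟩ := stdNormalLaw_exp_diag hA.eigenvalues hse
  have hcont : Continuous fun g : ι → ℝ => g ⬝ᵥ A *ᵥ g := by
    simp only [dotProduct, mulVec]; fun_prop
  have hmeas : (stdNormalLaw ι).real {g | t ≤ g ⬝ᵥ A *ᵥ g}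
      = (stdNormalLaw ι).real {x | t ≤ ∑ i, hA.eigenvalues i * x i ^ 2} := by
    rw [stdNormalLaw_real_rotate hA.eigenvectorBasis
      (measurableSet_le measurable_const hcont.measurable)]
    simp only [Set.mem_ofPred_eq, hA.quadForm_eq]
  rw [hmeas]
  have htr : A.trace = ∑ i, hA.eigenvalues i := by
    simpa using hA.trace_eq_sum_eigenvalues
  have hch : (stdNormalLaw ι).real {x | t ≤ ∑ i, hA.eigenvalues i * x i ^ 2}
      ≤ Real.exp (-s * t) * ∫ x, Real.exp (s * ∑ i, hA.eigenvalues i * x i ^ 2) ∂stdNormalLaw ι :=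
    measure_ge_le_exp_mul_mgf t hs hint
  have hsplit : Real.exp (-(s * t) + s * A.trace + 2 * s ^ 2 * ∑ i, ∑ j, A i j ^ 2)
      = Real.exp (-s * t) * Real.exp (s * ∑ i, hA.eigenvalues i
        + 2 * s ^ 2 * ∑ i, hA.eigenvalues i ^ 2) := by
    rw [← Real.exp_add, htr, ← hA.sum_eigenvalues_sq, neg_mul, add_assoc]
  rw [hsplit]
  exact hch.trans (mul_le_mul_of_nonneg_left hle (Real.exp_pos _).le)

end Chaos

/-! ### Tails for Hermitian chaoses, complex linear forms and weighted chi-squares. -/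

section GaussianTails

variable {ι κ : Type*} [Fintype ι] [Fintype κ]

/-- `M.OpLe a` says that the operator norm of `M` for the Euclidean norms is at most `a`. -/
def Matrix.OpLe (M : Matrix ι κ ℂ) (a : ℝ) : Prop :=
  ∀ w : κ → ℂ, ∑ i, ‖(M *ᵥ w) i‖ ^ 2 ≤ a ^ 2 * ∑ j, ‖w j‖ ^ 2

theorem norm_sum_mul_sq_le (v w : ι → ℂ) :
    ‖∑ i, v i * w i‖ ^ 2 ≤ (∑ i, ‖v i‖ ^ 2) * ∑ i, ‖w i‖ ^ 2 := by
  have h1 : ‖∑ i, v i * w i‖ ≤ ∑ i, ‖v i‖ * ‖w i‖ :=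
    (norm_sum_le _ _).trans_eq (Finset.sum_congr rfl fun i _ => norm_mul _ _)
  calc ‖∑ i, v i * w i‖ ^ 2 ≤ (∑ i, ‖v i‖ * ‖w i‖) ^ 2 := by gcongr
    _ ≤ _ := Finset.sum_mul_sq_le_sq_mul_sq _ _ _

theorem Matrix.OpLe.norm_bilin_sq_le {M : Matrix ι κ ℂ} {a : ℝ} (h : M.OpLe a) (v : ι → ℂ)
    (w : κ → ℂ) :
    ‖∑ i, v i * (M *ᵥ w) i‖ ^ 2 ≤ a ^ 2 * ((∑ i, ‖v i‖ ^ 2) * ∑ j, ‖w j‖ ^ 2) := by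
  refine (norm_sum_mul_sq_le _ _).trans ?_
  have h1 : 0 ≤ ∑ i, ‖v i‖ ^ 2 := by positivity
  nlinarith [mul_le_mul_of_nonneg_left (h w) h1]

theorem Matrix.OpLe.norm_bilin_le {M : Matrix ι ι ℂ} {a : ℝ} (ha : 0 ≤ a) (h : M.OpLe a)
    {v w : ι → ℂ} (hvw : ∀ i, ‖v i‖ = ‖w i‖) :
    ‖∑ i, v i * (M *ᵥ w) i‖ ≤ a * ∑ i, ‖w i‖ ^ 2 := by
  have h1 := h.norm_bilin_sq_le v w
  simp only [hvw] at h1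
  have h2 : 0 ≤ a * ∑ i, ‖w i‖ ^ 2 := by positivity
  refine abs_le_of_sq_le_sq' ?_ h2 |>.2
  rw [mul_pow, pow_two (∑ i, _)]
  exact h1

variable [DecidableEq ι]

/-- On real vectors a Hermitian form is real and is given by the entrywise real part of `B`, which
is symmetric, still traceless, and no larger in either norm. Apply the real tail to it and to its
negative. -/
theorem stdNormalLaw_hermitian_tail {B : Matrix ι ι ℂ} (hB : B.IsHermitian) {a s : ℝ}
    (ha : 0 ≤ a) (hop : B.OpLe a) (htr : B.trace = 0) (hF : ∑ i, ∑ j, ‖B i j‖ ^ 2 ≤ 1)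
    (hs : 0 ≤ s) (hsa : 4 * a * s ≤ 1) (t : ℝ) :
    (stdNormalLaw ι).real {g | t ≤ ‖∑ i, ∑ j, ((g i * g j : ℝ) : ℂ) * B i j‖}
      ≤ 2 * Real.exp (-(s * t) + 2 * s ^ 2) := by
  set A : Matrix ι ι ℝ := B.map Complex.re with hA
  have hAh : A.IsHermitian := by
    ext i j
    simp only [hA, conjTranspose_apply, map_apply, star_trivial]
    rw [← hB.apply i j]; simp
  have hAtr : A.trace = 0 := by
    have := congrArg Complex.re htr
    simpa [Matrix.trace, hA] using this
  have hAF : ∑ i, ∑ j, A i j ^ 2 ≤ 1 := by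
    refine le_trans ?_ hF
    refine Finset.sum_le_sum fun i _ => Finset.sum_le_sum fun j _ => ?_
    rw [← sq_abs]
    have := Complex.abs_re_le_norm (B i j)
    gcongr
    exact this
  have hq : ∀ v : ι → ℝ, v ⬝ᵥ A *ᵥ v = (∑ i, ∑ j, ((v i * v j : ℝ) : ℂ) * B i j).re := by
    intro v
    simp only [dotProduct, mulVec, Complex.re_sum, Complex.re_ofReal_mul, Finset.mul_sum, hA,
      map_apply]
    exact Finset.sum_congr rfl fun i _ => Finset.sum_congr rfl fun j _ => by ring
  have him : ∀ v : ι → ℝ, (∑ i, ∑ j, ((v i * v j : ℝ) : ℂ) * B i j).im = 0 := by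
    intro v
    rw [← Complex.conj_eq_iff_im, map_sum]
    simp only [map_sum, map_mul, Complex.conj_ofReal]
    rw [Finset.sum_comm]
    refine Finset.sum_congr rfl fun i _ => Finset.sum_congr rfl fun j _ => ?_
    rw [← hB.apply i j, mul_comm (v j)]; rfl
  have hb : ∀ v : ι → ℝ, |v ⬝ᵥ A *ᵥ v| ≤ a * ∑ i, v i ^ 2 := by
    intro v
    rw [hq]
    refine (Complex.abs_re_le_norm _).trans ?_
    have h := hop.norm_bilin_le ha (v := fun i => (v i : ℂ)) (w := fun i => (v i : ℂ))
      fun _ => rfl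
    simp only [Complex.norm_real, Real.norm_eq_abs, sq_abs] at h
    refine le_trans (le_of_eq ?_) h
    congr 1
    simp only [mulVec, dotProduct, Finset.mul_sum]
    exact Finset.sum_congr rfl fun i _ => Finset.sum_congr rfl fun j _ => by push_cast; ring
  have hsub : {g : ι → ℝ | t ≤ ‖∑ i, ∑ j, ((g i * g j : ℝ) : ℂ) * B i j‖}
      ⊆ {g | t ≤ g ⬝ᵥ A *ᵥ g} ∪ {g | t ≤ g ⬝ᵥ (-A) *ᵥ g} := by
    intro g hg
    simp only [Set.mem_ofPred_eq, Set.mem_union] at hg ⊢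
    have h1 : ‖∑ i, ∑ j, ((g i * g j : ℝ) : ℂ) * B i j‖ = |g ⬝ᵥ A *ᵥ g| := by
      rw [hq]
      exact (Complex.abs_re_eq_norm.2 (him g)).symm
    rw [h1] at hg
    rw [neg_mulVec, dotProduct_neg]
    exact le_abs.1 hg
  have h1 := stdNormalLaw_quadForm_tail hAh (fun v => (le_abs_self _).trans (hb v)) hs hsa t
  have h2 := stdNormalLaw_quadForm_tail hAh.neg
    (fun v => by rw [neg_mulVec, dotProduct_neg]; exact (neg_le_abs _).trans (hb v)) hs hsa t
  simp only [trace_neg, hAtr, Matrix.neg_apply, neg_sq, neg_zero, mul_zero, add_zero] at h1 h2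
  have h3 : Real.exp (-(s * t) + 2 * s ^ 2 * ∑ i, ∑ j, A i j ^ 2)
      ≤ Real.exp (-(s * t) + 2 * s ^ 2) := by
    apply Real.exp_le_exp.2
    nlinarith [sq_nonneg s]
  calc _ ≤ _ := measureReal_mono hsub
    _ ≤ _ := measureReal_union_le _ _
    _ ≤ _ := by linarith

/-- The squared modulus is the quadratic form of `Re (c c*)`, whose trace, Frobenius norm and top
eigenvalue are all at most `1`. Taking `s = 1/4` leaves the constant `1/4 + 2/16 = 3/8`. -/
theorem stdNormalLaw_linear_tail {c : ι → ℂ} (hc : ∑ i, ‖c i‖ ^ 2 ≤ 1) (u : ℝ) :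
    (stdNormalLaw ι).real {g | u ≤ ‖∑ i, (g i : ℂ) * c i‖ ^ 2}
      ≤ Real.exp (-(u / 4) + 3 / 8) := by
  set A : Matrix ι ι ℝ := of fun i j => (c i * (starRingEnd ℂ) (c j)).re with hA
  have hAh : A.IsHermitian := by
    ext i j
    simp only [hA, conjTranspose_apply, of_apply, star_trivial, Complex.mul_re, Complex.conj_re,
      Complex.conj_im]
    ring
  have hq : ∀ v : ι → ℝ, v ⬝ᵥ A *ᵥ v = ‖∑ i, (v i : ℂ) * c i‖ ^ 2 := by
    intro v
    have h1 : ((‖∑ i, (v i : ℂ) * c i‖ ^ 2 : ℝ) : ℂ) =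
        ∑ i, ∑ j, ((v i * v j : ℝ) : ℂ) * (c i * (starRingEnd ℂ) (c j)) := by
      push_cast
      rw [← Complex.mul_conj', map_sum, Finset.sum_mul_sum]
      refine Finset.sum_congr rfl fun i _ => Finset.sum_congr rfl fun j _ => ?_
      rw [map_mul, Complex.conj_ofReal]; ring
    have h2 := congrArg Complex.re h1
    rw [Complex.ofReal_re] at h2
    rw [h2]
    simp only [Complex.re_sum, Complex.re_ofReal_mul, dotProduct, mulVec, Finset.mul_sum, hA, of_apply]
    exact Finset.sum_congr rfl fun i _ => Finset.sum_congr rfl fun j _ => by ring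
  have hc0 : 0 ≤ ∑ i, ‖c i‖ ^ 2 := by positivity
  have hop : ∀ v : ι → ℝ, v ⬝ᵥ A *ᵥ v ≤ 1 * ∑ i, v i ^ 2 := by
    intro v
    rw [hq, one_mul]
    have h := norm_sum_mul_sq_le (fun i => (v i : ℂ)) c
    simp only [Complex.norm_real, Real.norm_eq_abs, sq_abs] at h
    have h0 : 0 ≤ ∑ i, v i ^ 2 := by positivity
    nlinarith
  have htr : A.trace ≤ 1 := by
    refine le_trans (le_of_eq ?_) hc
    refine Finset.sum_congr rfl fun i _ => ?_
    simp only [hA, diag_apply, of_apply, Complex.mul_conj, Complex.ofReal_re, Complex.normSq_eq_norm_sq]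
  have hF : ∑ i, ∑ j, A i j ^ 2 ≤ 1 := by
    calc ∑ i, ∑ j, A i j ^ 2 ≤ ∑ i, ∑ j, ‖c i‖ ^ 2 * ‖c j‖ ^ 2 := by
          refine Finset.sum_le_sum fun i _ => Finset.sum_le_sum fun j _ => ?_
          have := Complex.abs_re_le_norm (c i * (starRingEnd ℂ) (c j))
          rw [norm_mul, RCLike.norm_conj] at this
          rw [← mul_pow, ← sq_abs]
          exact pow_le_pow_left₀ (abs_nonneg _) this 2
      _ = (∑ i, ‖c i‖ ^ 2) * ∑ i, ‖c i‖ ^ 2 := by rw [Finset.sum_mul_sum]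
      _ ≤ 1 := by nlinarith
  have h := stdNormalLaw_quadForm_tail hAh hop (s := 1 / 4) (by norm_num) (by norm_num) u
  simp only [hq] at h
  refine h.trans (Real.exp_le_exp.2 ?_)
  linarith

theorem stdNormalLaw_diag_tail {d : ι → ℝ} (hd : ∀ i, d i ≤ 1) {s : ℝ} (hs : 0 ≤ s)
    (hs4 : s ≤ 1 / 4) (t : ℝ) :
    (stdNormalLaw ι).real {g | t ≤ ∑ i, d i * g i ^ 2}
      ≤ Real.exp (-(s * t) + s * ∑ i, d i + 2 * s ^ 2 * ∑ i, d i ^ 2) := by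
  have hq : ∀ v : ι → ℝ, v ⬝ᵥ (diagonal d) *ᵥ v = ∑ i, d i * v i ^ 2 := by
    intro v
    simp only [dotProduct, mulVec_diagonal]
    exact Finset.sum_congr rfl fun i _ => by ring
  have h := stdNormalLaw_quadForm_tail (A := diagonal d) (a := 1) (s := s)
    (isHermitian_diagonal d) (fun v => by
      rw [hq, one_mul]
      exact Finset.sum_le_sum fun i _ => by nlinarith [hd i, sq_nonneg (v i)]) hs (by linarith) t
  simp only [hq] at h
  have hF : ∑ i, ∑ j, (diagonal d) i j ^ 2 = ∑ i, d i ^ 2 := by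
    refine Finset.sum_congr rfl fun i _ => ?_
    rw [Finset.sum_eq_single i] <;> simp +contextual [eq_comm]
  rwa [hF, trace_diagonal] at h

end GaussianTails

/-! ### Operator and Frobenius norms of Kronecker products and of off-diagonal parts. -/

section Matrices

theorem Matrix.IsHermitian.kronecker' {ι κ : Type*} {A : Matrix ι ι ℂ} {B : Matrix κ κ ℂ} (hA : A.IsHermitian)
    (hB : B.IsHermitian) : (A ⊗ₖ B).IsHermitian := by
  rw [Matrix.IsHermitian, conjTranspose_kronecker, hA.eq, hB.eq]

variable {ι κ : Type*} [Fintype ι] [Fintype κ]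

/-- `A ⊗ B` acts as `B` on the second index followed by `A` on the first, each with the other index
frozen. -/
theorem Matrix.OpLe.kronecker {A : Matrix ι ι ℂ} {B : Matrix κ κ ℂ} {a b : ℝ} (hA : A.OpLe a)
    (hB : B.OpLe b) : (A ⊗ₖ B).OpLe (a * b) := by
  intro w
  set u : ι → κ → ℂ := fun i j => ∑ l, B j l * w (i, l) with hu
  have h1 : ∀ i j, ((A ⊗ₖ B) *ᵥ w) (i, j) = (A *ᵥ fun i' => u i' j) i := by
    intro i j
    simp only [mulVec, dotProduct, Fintype.sum_prod_type, kroneckerMap_apply, hu, Finset.mul_sum,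
      mul_assoc]
  rw [Fintype.sum_prod_type, Finset.sum_comm, Fintype.sum_prod_type]
  simp only [h1]
  calc ∑ j, ∑ i, ‖(A *ᵥ fun i' => u i' j) i‖ ^ 2
      ≤ ∑ j, a ^ 2 * ∑ i, ‖u i j‖ ^ 2 := Finset.sum_le_sum fun j _ => hA _
    _ = a ^ 2 * ∑ i, ∑ j, ‖u i j‖ ^ 2 := by rw [← Finset.mul_sum, Finset.sum_comm]
    _ ≤ a ^ 2 * ∑ i, b ^ 2 * ∑ j, ‖w (i, j)‖ ^ 2 := by
        refine mul_le_mul_of_nonneg_left (Finset.sum_le_sum fun i _ => ?_) (sq_nonneg a)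
        exact hB fun j => w (i, j)
    _ = _ := by rw [← Finset.mul_sum]; ring

theorem Matrix.sum_norm_sq_kronecker (A : Matrix ι ι ℂ) (B : Matrix κ κ ℂ) :
    ∑ p, ∑ q, ‖(A ⊗ₖ B) p q‖ ^ 2 = (∑ i, ∑ j, ‖A i j‖ ^ 2) * ∑ i, ∑ j, ‖B i j‖ ^ 2 := by
  simp only [Fintype.sum_prod_type, kroneckerMap_apply, norm_mul, mul_pow]
  rw [Finset.sum_mul_sum]
  refine Finset.sum_congr rfl fun i _ => Finset.sum_congr rfl fun j _ => ?_
  rw [Finset.sum_mul_sum]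

variable [DecidableEq ι]

/-- The matrix `X` with its diagonal replaced by zero. -/
def Matrix.offDiag (X : Matrix ι ι ℂ) : Matrix ι ι ℂ := X - diagonal X.diag

theorem Matrix.offDiag_apply {ι : Type*} [DecidableEq ι] (X : Matrix ι ι ℂ) (i j : ι) :
    X.offDiag i j = if i = j then 0 else X i j := by
  by_cases h : i = j
  · subst h; simp [Matrix.offDiag]
  · simp [Matrix.offDiag, h]

theorem Matrix.norm_offDiag_apply_le {ι : Type*} [DecidableEq ι] (X : Matrix ι ι ℂ) (i j : ι) :
    ‖X.offDiag i j‖ ≤ ‖X i j‖ := by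
  rw [offDiag_apply]; split_ifs <;> simp

theorem Matrix.IsHermitian.offDiag {ι : Type*} [DecidableEq ι] {X : Matrix ι ι ℂ} (hX : X.IsHermitian) :
    X.offDiag.IsHermitian := by
  ext i j
  simp only [conjTranspose_apply, offDiag_apply, eq_comm (a := j)]
  split_ifs
  · simp
  · exact hX.apply i j

theorem Matrix.trace_offDiag (X : Matrix ι ι ℂ) : X.offDiag.trace = 0 := by
  simp [Matrix.trace, offDiag_apply]

theorem Matrix.OpLe.norm_apply_sq_le {X : Matrix ι ι ℂ} {a : ℝ} (h : X.OpLe a) (i j : ι) :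
    ‖X i j‖ ^ 2 ≤ a ^ 2 := by
  have h1 := h (Pi.single j 1)
  simp only [mulVec_single_one] at h1
  have h2 : ∑ k, ‖(Pi.single j 1 : ι → ℂ) k‖ ^ 2 = 1 := by
    rw [Finset.sum_eq_single j] <;> simp +contextual
  rw [h2, mul_one] at h1
  exact (Finset.single_le_sum (f := fun k => ‖X k j‖ ^ 2) (fun k _ => by positivity)
    (Finset.mem_univ i)).trans h1

theorem Matrix.OpLe.offDiag {X : Matrix ι ι ℂ} {a : ℝ} (h : X.OpLe a) :
    X.offDiag.OpLe (2 * a) := by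
  intro w
  -- Diagonal entries are bounded by the operator norm, so `(x + y)² ≤ 2x² + 2y²` gives `4a²` after
  -- summation.
  have h1 : ∀ i, ‖(X.offDiag *ᵥ w) i‖ ^ 2 ≤ 2 * ‖(X *ᵥ w) i‖ ^ 2 + 2 * (a ^ 2 * ‖w i‖ ^ 2) := by
    intro i
    rw [Matrix.offDiag, sub_mulVec, Pi.sub_apply, mulVec_diagonal]
    have h2 := norm_sub_le ((X *ᵥ w) i) (X.diag i * w i)
    have h3 : ‖X.diag i * w i‖ ^ 2 ≤ a ^ 2 * ‖w i‖ ^ 2 := by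
      rw [norm_mul, mul_pow]
      exact mul_le_mul_of_nonneg_right (h.norm_apply_sq_le i i) (sq_nonneg _)
    have h4 : ‖(X *ᵥ w) i - X.diag i * w i‖ ^ 2 ≤ (‖(X *ᵥ w) i‖ + ‖X.diag i * w i‖) ^ 2 := by
      gcongr
    nlinarith [sq_nonneg (‖(X *ᵥ w) i‖ - ‖X.diag i * w i‖)]
  have h5 := Finset.sum_le_sum fun i (_ : i ∈ Finset.univ) => h1 i
  rw [Finset.sum_add_distrib, ← Finset.mul_sum, ← Finset.mul_sum, ← Finset.mul_sum] at h5
  nlinarith [h w]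

end Matrices

/-! ### Flat matrices and trace-norm duality. -/

section Flat

variable {N : ℕ}

/-- Hermitian matrices of rank at most `r` and operator norm at most `1 / √r`, with an explicit
decomposition into matrices of rank one. -/
structure Matrix.IsFlat (r : ℕ) (X : Matrix (Fin N) (Fin N) ℂ) : Prop where
  isHermitian : X.IsHermitian
  opLe : X.OpLe (1 / √r)
  frob : ∑ i, ∑ j, ‖X i j‖ ^ 2 ≤ 1
  decomp : ∃ (l : Fin r → ℝ) (v : Fin r → Fin N → ℂ), (∀ a, |l a| ≤ 1 / √r) ∧
    (∀ a, ∑ i, ‖v a i‖ ^ 2 ≤ 1) ∧ X = ∑ a, (l a : ℂ) • vecMulVec (v a) (star (v a))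

/-- Dual form of the bound `m` on the trace norm of `Y`. -/
def Matrix.NucLe (Y : Matrix (Fin N) (Fin N) ℂ) (m : ℝ) : Prop :=
  ∀ (f : Matrix (Fin N) (Fin N) ℂ →ₗ[ℂ] ℂ) (K : ℝ), 0 ≤ K →
    (∀ y : Fin N → ℂ, ‖f (vecMulVec y (star y))‖ ≤ K * ∑ i, ‖y i‖ ^ 2) → ‖f Y‖ ≤ m * K

theorem Matrix.offDiag_eq_sub_sum (X : Matrix (Fin N) (Fin N) ℂ) :
    X.offDiag = X - ∑ i, X i i • vecMulVec (Pi.single i 1) (star (Pi.single i (1 : ℂ))) := by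
  rw [Matrix.offDiag]
  congr 1
  ext j k
  simp only [Matrix.sum_apply, Matrix.smul_apply, vecMulVec_apply, Pi.star_apply, smul_eq_mul,
    diagonal_apply, diag_apply]
  rw [Finset.sum_eq_single j (fun i _ hi => by simp [Pi.single_apply, hi.symm]) (by simp)]
  by_cases h : j = k
  · subst h; simp
  · simp [h, Ne.symm h]

/-- The `r` rank-one terms have weight at most `1/√r` each, in total `√r`. The removed diagonal
costs another `√r`, since `∑ |Xᵢᵢ|` is bounded by the same total weight. -/
theorem Matrix.IsFlat.nucLe_offDiag {r : ℕ} {X : Matrix (Fin N) (Fin N) ℂ} (hX : X.IsFlat r) :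
    X.offDiag.NucLe (2 * √r) := by
  intro f K hK hf
  obtain ⟨l, v, hl, hv, hXe⟩ := hX.decomp
  have hsum : ∑ a, |l a| * ∑ i, ‖v a i‖ ^ 2 ≤ √r := by
    calc ∑ a, |l a| * ∑ i, ‖v a i‖ ^ 2 ≤ ∑ _a : Fin r, 1 / √r * 1 := by
          refine Finset.sum_le_sum fun a _ => ?_
          exact mul_le_mul (hl a) (hv a) (by positivity) (by positivity)
      _ = r / √r := by simp [div_eq_mul_inv]
      _ ≤ √r := le_of_eq Real.div_sqrt
  have h1 : ‖f X‖ ≤ √r * K := by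
    calc ‖f X‖ ≤ ∑ a, ‖f ((l a : ℂ) • vecMulVec (v a) (star (v a)))‖ := by
          conv_lhs => rw [hXe, map_sum]
          exact norm_sum_le _ _
      _ ≤ ∑ a, (|l a| * ∑ i, ‖v a i‖ ^ 2) * K := by
          refine Finset.sum_le_sum fun a _ => ?_
          rw [map_smul, norm_smul, Complex.norm_real, Real.norm_eq_abs]
          have := mul_le_mul_of_nonneg_left (hf (v a)) (abs_nonneg (l a))
          linarith
      _ ≤ _ := by
          rw [← Finset.sum_mul]
          exact mul_le_mul_of_nonneg_right hsum hK
  have hdiag : ∑ i, ‖X i i‖ ≤ √r := by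
    refine le_trans ?_ hsum
    calc ∑ i, ‖X i i‖ ≤ ∑ i, ∑ a, |l a| * ‖v a i‖ ^ 2 := by
          refine Finset.sum_le_sum fun i _ => ?_
          rw [hXe, Matrix.sum_apply]
          refine (norm_sum_le _ _).trans_eq (Finset.sum_congr rfl fun a _ => ?_)
          simp [vecMulVec_apply, pow_two]
      _ = _ := by
          rw [Finset.sum_comm]
          exact Finset.sum_congr rfl fun a _ => by rw [Finset.mul_sum]
  have h2 : ‖∑ i, X i i • f (vecMulVec (Pi.single i 1) (star (Pi.single i (1 : ℂ))))‖
      ≤ √r * K := by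
    calc _ ≤ ∑ i, ‖X i i • f (vecMulVec (Pi.single i 1) (star (Pi.single i (1 : ℂ))))‖ :=
          norm_sum_le _ _
      _ ≤ ∑ i, ‖X i i‖ * K := by
          refine Finset.sum_le_sum fun i _ => ?_
          rw [norm_smul]
          refine mul_le_mul_of_nonneg_left ((hf _).trans_eq ?_) (norm_nonneg _)
          rw [Finset.sum_eq_single i] <;> simp +contextual
      _ ≤ _ := by
          rw [← Finset.sum_mul]
          exact mul_le_mul_of_nonneg_right hdiag hK
  rw [offDiag_eq_sub_sum, map_sub, map_sum]
  simp only [map_smul]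
  refine (norm_sub_le _ _).trans ?_
  linarith

end Flat

/-! ### The form `gᵀ (X ⊗ Y ⊗ Z) g` and its bound by the injective norm of `g`. -/

section Form

variable {N : ℕ}

/-- The quadratic form of `X ⊗ Y ⊗ Z` at `g`. -/
noncomputable def quadForm₃ (g : Triple N → ℝ) (X Y Z : Matrix (Fin N) (Fin N) ℂ) : ℂ :=
  ∑ p, ∑ q, ((g p * g q : ℝ) : ℂ) * (X ⊗ₖ (Y ⊗ₖ Z)) p q

theorem trilin_ofVector (g : Triple N → ℝ) (X Y Z : Matrix (Fin N) (Fin N) ℂ) :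
    (PairTensor.ofVector g).trilin X Y Z = quadForm₃ g X.offDiag Y.offDiag Z.offDiag := by
  refine Finset.sum_congr rfl fun p _ => Finset.sum_congr rfl fun q _ => ?_
  simp only [PairTensor.ofVector, kroneckerMap_apply, offDiag_apply]
  by_cases h1 : p.1 = q.1 <;> by_cases h2 : p.2.1 = q.2.1 <;> by_cases h3 : p.2.2 = q.2.2 <;>
    simp [h1, h2, h3, mul_assoc]

/-- The linear map `Z ↦ quadForm₃ g X Y Z`. -/
noncomputable def quadForm₃Lin (g : Triple N → ℝ) (X Y : Matrix (Fin N) (Fin N) ℂ) :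
    Matrix (Fin N) (Fin N) ℂ →ₗ[ℂ] ℂ where
  toFun Z := quadForm₃ g X Y Z
  map_add' Z W := by
    simp only [quadForm₃, kroneckerMap_apply, Matrix.add_apply, mul_add, Finset.sum_add_distrib]
  map_smul' c Z := by
    simp only [quadForm₃, kroneckerMap_apply, Matrix.smul_apply, smul_eq_mul, RingHom.id_apply,
      Finset.mul_sum]
    exact Finset.sum_congr rfl fun p _ => Finset.sum_congr rfl fun q _ => by ring

/-- The cyclic rotation of the three indices. -/
def Triple.rotate (N : ℕ) : Triple N ≃ Triple N where
  toFun p := (p.2.1, p.2.2, p.1)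
  invFun p := (p.2.2, p.1, p.2.1)
  left_inv _ := rfl
  right_inv _ := rfl

theorem Triple.rotate_apply (p : Triple N) : Triple.rotate N p = (p.2.1, p.2.2, p.1) := rfl

/-- Cyclic symmetry lets an argument about one factor, or about the largest rank, be written once
and transported to the others. -/
theorem quadForm₃_rotate (g : Triple N → ℝ) (X Y Z : Matrix (Fin N) (Fin N) ℂ) :
    quadForm₃ (g ∘ (Triple.rotate N).symm) Y Z X = quadForm₃ g X Y Z := by
  simp only [quadForm₃]
  rw [← (Triple.rotate N).sum_comp]
  refine Finset.sum_congr rfl fun p _ => ?_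
  rw [← (Triple.rotate N).sum_comp]
  refine Finset.sum_congr rfl fun q _ => ?_
  simp only [Function.comp_apply, Equiv.symm_apply_apply, kroneckerMap_apply]
  simp only [Triple.rotate_apply]
  ring

/-- The square of the injective norm of the `3`-tensor `g` is at most `B`. -/
def InjLe (g : Triple N → ℝ) (B : ℝ) : Prop :=
  ∀ x y z : Fin N → ℂ, ‖∑ p : Triple N, (g p : ℂ) * (x p.1 * (y p.2.1 * z p.2.2))‖ ^ 2
    ≤ B * ((∑ i, ‖x i‖ ^ 2) * ((∑ i, ‖y i‖ ^ 2) * ∑ i, ‖z i‖ ^ 2))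

theorem InjLe.rotate {g : Triple N → ℝ} {B : ℝ} (h : InjLe g B) :
    InjLe (g ∘ (Triple.rotate N).symm) B := by
  intro x y z
  rw [← (Triple.rotate N).sum_comp]
  have h1 := h z x y
  simp only [Function.comp_apply, Equiv.symm_apply_apply]
  simp only [Triple.rotate_apply]
  refine le_trans (le_of_eq ?_) (h1.trans_eq (by ring))
  congr 2
  exact Finset.sum_congr rfl fun p _ => by ring

/-- Contracting `g` with `y ⊗ z` gives a vector `v`, and the form becomes `vᵀ X v̄`, at most
`a‖v‖²`. Testing the injective bound on `v̄, y, z` yields `‖v‖⁴ ≤ B ‖v‖² ‖y‖² ‖z‖²`, hence control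
of `‖v‖²`. -/
theorem norm_quadForm₃_rankOne_le {g : Triple N → ℝ} {a B : ℝ} {X : Matrix (Fin N) (Fin N) ℂ}
    (ha : 0 ≤ a) (hX : X.OpLe a) (hB : 0 ≤ B) (hg : InjLe g B) (y z : Fin N → ℂ) :
    ‖quadForm₃ g X (vecMulVec y (star y)) (vecMulVec z (star z))‖
      ≤ a * B * (∑ i, ‖y i‖ ^ 2) * ∑ i, ‖z i‖ ^ 2 := by
  set v : Fin N → ℂ := fun i => ∑ q : Fin N × Fin N, (g (i, q) : ℂ) * (y q.1 * z q.2) with hv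
  have h1 : quadForm₃ g X (vecMulVec y (star y)) (vecMulVec z (star z))
      = ∑ i, v i * (X *ᵥ star v) i := by
    simp only [quadForm₃, mulVec, dotProduct, hv, Pi.star_apply, star_sum, Finset.mul_sum,
      Finset.sum_mul, Fintype.sum_prod_type (α₁ := Fin N) (α₂ := Fin N × Fin N),
      kroneckerMap_apply, vecMulVec_apply]
    refine Finset.sum_congr rfl fun i _ => ?_
    rw [Finset.sum_comm]
    refine Finset.sum_congr rfl fun i' _ => ?_
    rw [Finset.sum_comm]
    refine Finset.sum_congr rfl fun q _ => Finset.sum_congr rfl fun q' _ => ?_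
    simp only [star_mul', Complex.star_def, Complex.conj_ofReal, Complex.ofReal_mul]
    ring
  set V : ℝ := ∑ i, ‖v i‖ ^ 2 with hV
  have hV0 : 0 ≤ V := by positivity
  have h2 : V ≤ B * ((∑ i, ‖y i‖ ^ 2) * ∑ i, ‖z i‖ ^ 2) := by
    have h3 := hg (star v) y z
    have h4 : ∑ p : Triple N, (g p : ℂ) * (star v p.1 * (y p.2.1 * z p.2.2)) = (V : ℂ) := by
      rw [Fintype.sum_prod_type]
      simp only [hV, Complex.ofReal_sum, Complex.ofReal_pow]
      refine Finset.sum_congr rfl fun i _ => ?_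
      rw [← Complex.mul_conj', mul_comm (v i)]
      conv_rhs => rw [hv]
      simp only [Finset.mul_sum, Pi.star_apply, Complex.star_def]
      exact Finset.sum_congr rfl fun q _ => by ring
    rw [h4, Complex.norm_real, Real.norm_eq_abs, sq_abs] at h3
    simp only [Pi.star_apply, norm_star] at h3
    rw [← hV] at h3
    rcases hV0.eq_or_lt with h0 | h0
    · rw [← h0]; positivity
    · have h5 : V * V ≤ V * (B * ((∑ i, ‖y i‖ ^ 2) * ∑ i, ‖z i‖ ^ 2)) := by linarith
      exact le_of_mul_le_mul_left h5 h0
  rw [h1]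
  have h6 := hX.norm_bilin_le ha (v := v) (w := star v) (fun i => by simp)
  simp only [Pi.star_apply, norm_star] at h6
  calc _ ≤ a * V := h6
    _ ≤ a * (B * ((∑ i, ‖y i‖ ^ 2) * ∑ i, ‖z i‖ ^ 2)) := mul_le_mul_of_nonneg_left h2 ha
    _ = _ := by ring

theorem norm_quadForm₃_le_of_nucLe {g : Triple N → ℝ} {a B m n : ℝ}
    {X Y Z : Matrix (Fin N) (Fin N) ℂ} (ha : 0 ≤ a) (hX : X.OpLe a) (hn : 0 ≤ n)
    (hY : Y.NucLe m) (hZ : Z.NucLe n) (hB : 0 ≤ B) (hg : InjLe g B) :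
    ‖quadForm₃ g X Y Z‖ ≤ m * (n * (a * B)) := by
  have h := hY (quadForm₃Lin (g ∘ (Triple.rotate N).symm ∘ (Triple.rotate N).symm) Z X)
    (n * (a * B)) (by positivity)
  have hrot : ∀ W, quadForm₃Lin (g ∘ (Triple.rotate N).symm ∘ (Triple.rotate N).symm) Z X W
      = quadForm₃ g X W Z := by
    intro W
    rw [← quadForm₃_rotate g X W Z, ← quadForm₃_rotate _ W Z X]
    rfl
  simp only [hrot] at h
  refine h fun y => ?_
  have h2 := hZ (quadForm₃Lin g X (vecMulVec y (star y))) (a * B * ∑ i, ‖y i‖ ^ 2)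
    (by positivity) fun z => norm_quadForm₃_rankOne_le ha hX hB hg y z
  refine h2.trans_eq (by ring)

/-- The unbalanced regime. Operator norm `1/√r` on `X` and trace norms `√s`, `√t` on the others
multiply to at most `1`; the `8` is one factor `2` per diagonal removed. -/
theorem norm_quadForm₃_flat_le_of_mul_le {g : Triple N → ℝ} {B : ℝ} {r s t : ℕ}
    {X Y Z : Matrix (Fin N) (Fin N) ℂ} (hX : X.IsFlat r) (hY : Y.IsFlat s) (hZ : Z.IsFlat t)
    (hB : 0 ≤ B) (hg : InjLe g B) (h : s * t ≤ r) :
    ‖quadForm₃ g X.offDiag Y.offDiag Z.offDiag‖ ≤ 8 * B := by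
  have h1 := norm_quadForm₃_le_of_nucLe (by positivity) hX.opLe.offDiag (by positivity)
    hY.nucLe_offDiag hZ.nucLe_offDiag hB hg
  refine h1.trans ?_
  have h2 : √s * √t ≤ √r := by
    rw [← Real.sqrt_mul (by positivity)]
    exact Real.sqrt_le_sqrt (by exact_mod_cast h)
  have h3 : √s * √t * (1 / √r) ≤ 1 := by
    rcases Nat.eq_zero_or_pos r with h0 | h0
    · subst h0; simp
    · have : (0 : ℝ) < √r := Real.sqrt_pos.2 (by exact_mod_cast h0)
      rw [mul_one_div, div_le_one this]
      exact h2
  calc _ = 8 * B * (√s * √t * (1 / √r)) := by ring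
    _ ≤ 8 * B * 1 := by gcongr
    _ = _ := by ring

end Form

/-! ### Finite nets by rounding coordinates to a grid. -/

section Nets

/-- One representative is kept per occupied grid cell. The net therefore consists of points of the
original set, so net points inherit its constraints (unit ball, flatness). -/
theorem exists_finset_net {α D : Type*} [Fintype D] (φ : α → D → ℝ) (hφ : ∀ x d, |φ x d| ≤ 1)
    {M : ℕ} (hM : 0 < M) :
    ∃ R : Finset α, R.card ≤ (2 * M + 1) ^ Fintype.card D ∧
      ∀ x, ∃ x' ∈ R, ∀ d, |φ x d - φ x' d| ≤ 1 / M := by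
  classical
  have hM' : (0 : ℝ) < M := by exact_mod_cast hM
  have hfl : ∀ x d, ⌊(M : ℝ) * (φ x d + 1)⌋₊ < 2 * M + 1 := by
    intro x d
    rw [Nat.lt_succ_iff]
    apply Nat.floor_le_of_le
    have := (abs_le.1 (hφ x d)).2
    push_cast
    nlinarith
  set cell : α → D → Fin (2 * M + 1) := fun x d => ⟨_, hfl x d⟩ with hcell
  obtain ⟨t, -, ht⟩ := Set.exists_subset_bijOn Set.univ cell
  have hfin : t.Finite := Set.Finite.of_injOn (fun _ _ => Set.mem_univ _) ht.injOn
    (Set.toFinite (Set.univ : Set (D → Fin (2 * M + 1))))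
  refine ⟨hfin.toFinset, ?_, fun x => ?_⟩
  · have h := Finset.card_le_card_of_injOn (s := hfin.toFinset)
      (t := (Finset.univ : Finset (D → Fin (2 * M + 1)))) cell (fun _ _ => Finset.mem_univ _)
      (by simpa using ht.injOn)
    simpa using h
  · obtain ⟨x', hx', he⟩ := ht.surjOn (Set.mem_image_of_mem cell (Set.mem_univ x))
    refine ⟨x', by simpa using hx', fun d => ?_⟩
    have h1 : ⌊(M : ℝ) * (φ x' d + 1)⌋₊ = ⌊(M : ℝ) * (φ x d + 1)⌋₊ :=
      congrArg Fin.val (congrFun he d)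
    have h0 : ∀ y, 0 ≤ (M : ℝ) * (φ y d + 1) := fun y =>
      mul_nonneg hM'.le (by linarith [(abs_le.1 (hφ y d)).1])
    have h2 := Nat.floor_le (h0 x)
    have h3 := Nat.lt_floor_add_one ((M : ℝ) * (φ x d + 1))
    have h4 := Nat.floor_le (h0 x')
    have h5 := Nat.lt_floor_add_one ((M : ℝ) * (φ x' d + 1))
    rw [h1] at h4 h5
    rw [abs_le]
    have h6 : (M : ℝ) * (1 / M) = 1 := by field_simp
    constructor
    · refine le_of_mul_le_mul_left ?_ hM'
      nlinarith
    · refine le_of_mul_le_mul_left ?_ hM'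
      nlinarith

theorem norm_mul₃_sub_le {a b c a' b' c' : ℂ} (hb : ‖b‖ ≤ 1) (hc : ‖c‖ ≤ 1)
    (ha' : ‖a'‖ ≤ 1) (hb' : ‖b'‖ ≤ 1) :
    ‖a * b * c - a' * b' * c'‖ ≤ ‖a - a'‖ + ‖b - b'‖ + ‖c - c'‖ := by
  have h : a * b * c - a' * b' * c' = (a - a') * (b * c) + a' * ((b - b') * c)
      + a' * b' * (c - c') := by ring
  rw [h]
  refine (norm_add₃_le).trans ?_
  simp only [norm_mul]
  have h1 : ‖a - a'‖ * (‖b‖ * ‖c‖) ≤ ‖a - a'‖ * (1 * 1) := by gcongr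
  have h2 : ‖a'‖ * (‖b - b'‖ * ‖c‖) ≤ 1 * (‖b - b'‖ * 1) := by gcongr
  have h3 : ‖a'‖ * ‖b'‖ * ‖c - c'‖ ≤ 1 * 1 * ‖c - c'‖ := by gcongr
  linarith

theorem norm_le_one_of_sum_sq_le {ι : Type*} [Fintype ι] {x : ι → ℂ} (h : ∑ i, ‖x i‖ ^ 2 ≤ 1)
    (i : ι) : ‖x i‖ ≤ 1 := by
  have h1 := (Finset.single_le_sum (f := fun k => ‖x k‖ ^ 2) (fun k _ => by positivity)
    (Finset.mem_univ i)).trans h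
  exact (sq_le_one_iff₀ (norm_nonneg _)).1 h1

theorem Complex.norm_sub_le_of_re_im {z w : ℂ} {e : ℝ} (h1 : |z.re - w.re| ≤ e)
    (h2 : |z.im - w.im| ≤ e) : ‖z - w‖ ≤ 2 * e := by
  have := Complex.norm_le_abs_re_add_abs_im (z - w)
  rw [Complex.sub_re, Complex.sub_im] at this
  linarith

theorem exists_ball_net (N : ℕ) {M : ℕ} (hM : 0 < M) :
    ∃ R : Finset (Fin N → ℂ), R.card ≤ (2 * M + 1) ^ (2 * N) ∧
      (∀ x ∈ R, ∑ i, ‖x i‖ ^ 2 ≤ 1) ∧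
      ∀ x : Fin N → ℂ, ∑ i, ‖x i‖ ^ 2 ≤ 1 → ∃ x' ∈ R, ∀ i, ‖x i - x' i‖ ≤ 2 * (1 / M) := by
  classical
  obtain ⟨R, hR, hn⟩ := exists_finset_net
    (α := {x : Fin N → ℂ // ∑ i, ‖x i‖ ^ 2 ≤ 1})
    (fun x => Sum.elim (fun i : Fin N => (x.1 i).re) fun i : Fin N => (x.1 i).im)
    (by
      rintro ⟨x, hx⟩ (i | i)
      · exact (Complex.abs_re_le_norm _).trans (norm_le_one_of_sum_sq_le hx i)
      · exact (Complex.abs_im_le_norm _).trans (norm_le_one_of_sum_sq_le hx i)) hM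
  refine ⟨R.image Subtype.val, Finset.card_image_le.trans (hR.trans_eq ?_), ?_, fun x hx => ?_⟩
  · simp [two_mul]
  · intro x hx
    obtain ⟨y, -, rfl⟩ := Finset.mem_image.1 hx
    exact y.2
  · obtain ⟨y, hy, hd⟩ := hn ⟨x, hx⟩
    refine ⟨y.1, Finset.mem_image_of_mem _ hy, fun i => ?_⟩
    exact Complex.norm_sub_le_of_re_im (hd (Sum.inl i)) (hd (Sum.inr i))

/-- The grid is laid on the parameters of the rank-one decomposition: `r` weights and `rN` complex
coordinates, at most `3Nr` reals. Each of the `r ≤ N` terms then moves an entry by at most `5/M`. -/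
theorem exists_flat_net {N r M : ℕ} (hM : 0 < M) (hr : 1 ≤ r) (hrN : r ≤ N) :
    ∃ R : Finset (Matrix (Fin N) (Fin N) ℂ), R.card ≤ (2 * M + 1) ^ (3 * N * r) ∧
      (∀ X ∈ R, X.IsFlat r) ∧
      ∀ X : Matrix (Fin N) (Fin N) ℂ, X.IsFlat r →
        ∃ X' ∈ R, ∀ i j, ‖X i j - X' i j‖ ≤ 5 * N / M := by
  classical
  choose l v hl hv hX using fun X : {X : Matrix (Fin N) (Fin N) ℂ // X.IsFlat r} => X.2.decomp
  have hr1 : 1 / √(r : ℝ) ≤ 1 := by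
    have : (1 : ℝ) ≤ √r := Real.one_le_sqrt.2 (by exact_mod_cast hr)
    exact (div_le_one (by linarith)).2 this
  have hv1 : ∀ X a i, ‖v X a i‖ ≤ 1 := fun X a => norm_le_one_of_sum_sq_le (hv X a)
  have hl1 : ∀ X a, |l X a| ≤ 1 := fun X a => (hl X a).trans hr1
  obtain ⟨R, hR, hn⟩ := exists_finset_net
    (fun X => Sum.elim (l X) (Sum.elim (fun p : Fin r × Fin N => (v X p.1 p.2).re)
      fun p : Fin r × Fin N => (v X p.1 p.2).im))
    (by
      rintro X (a | p | p)
      · exact hl1 X a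
      · exact (Complex.abs_re_le_norm _).trans (hv1 X p.1 p.2)
      · exact (Complex.abs_im_le_norm _).trans (hv1 X p.1 p.2)) hM
  refine ⟨R.image Subtype.val, Finset.card_image_le.trans (hR.trans ?_), ?_, fun X hXf => ?_⟩
  · refine Nat.pow_le_pow_right (by omega) ?_
    simp only [Fintype.card_sum, Fintype.card_prod, Fintype.card_fin]
    nlinarith
  · intro x hx
    obtain ⟨y, -, rfl⟩ := Finset.mem_image.1 hx
    exact y.2
  · obtain ⟨Y, hY, hd⟩ := hn ⟨X, hXf⟩
    refine ⟨Y.1, Finset.mem_image_of_mem _ hY, fun i j => ?_⟩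
    have h1 : X = ∑ a, (l ⟨X, hXf⟩ a : ℂ) • vecMulVec (v ⟨X, hXf⟩ a) (star (v ⟨X, hXf⟩ a)) :=
      hX ⟨X, hXf⟩
    have hnv : ∀ a i, ‖v ⟨X, hXf⟩ a i - v Y a i‖ ≤ 2 * (1 / M) := fun a i =>
      Complex.norm_sub_le_of_re_im (hd (Sum.inr (Sum.inl (a, i)))) (hd (Sum.inr (Sum.inr (a, i))))
    rw [h1, hX Y, Matrix.sum_apply, Matrix.sum_apply, ← Finset.sum_sub_distrib]
    calc _ ≤ ∑ a : Fin r, (5 * (1 / M) : ℝ) := by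
          refine norm_sum_le_of_le _ fun a _ => ?_
          simp only [Matrix.smul_apply, vecMulVec_apply, smul_eq_mul, Pi.star_apply, ← mul_assoc]
          refine (norm_mul₃_sub_le (hv1 _ _ _) (by simpa using hv1 ⟨X, hXf⟩ a j)
            (by simpa using hl1 Y a) (hv1 _ _ _)).trans ?_
          rw [← Complex.ofReal_sub, Complex.norm_real, Real.norm_eq_abs, ← star_sub, norm_star]
          have := hd (Sum.inl a)
          simp only [Sum.elim_inl] at this
          linarith [hnv a i, hnv a j]
      _ = r * (5 * (1 / M)) := by simp
      _ ≤ N * (5 * (1 / M)) := by gcongr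
      _ = _ := by ring

end Nets

/-! ### Dyadic spectral decomposition into flat matrices. -/

section Spectral

variable {ι : Type*} [Fintype ι] [DecidableEq ι]

theorem Matrix.sum_norm_sq_mulVec_of_unitary {U : Matrix ι ι ℂ} (hU : Uᴴ * U = 1) (w : ι → ℂ) :
    ∑ i, ‖(U *ᵥ w) i‖ ^ 2 = ∑ i, ‖w i‖ ^ 2 := by
  have h : ∀ x : ι → ℂ, ((∑ i, ‖x i‖ ^ 2 : ℝ) : ℂ) = star x ⬝ᵥ x := by
    intro x
    simp only [dotProduct, Pi.star_apply, Complex.ofReal_sum, Complex.ofReal_pow]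
    exact Finset.sum_congr rfl fun i _ => by rw [← Complex.conj_mul']; rfl
  have h2 : star (U *ᵥ w) ⬝ᵥ (U *ᵥ w) = star w ⬝ᵥ w := by
    rw [star_mulVec, ← dotProduct_mulVec, mulVec_mulVec, hU, one_mulVec]
  rw [← h, ← h] at h2
  exact_mod_cast h2

theorem Matrix.sum_norm_sq_unitary_mul {U : Matrix ι ι ℂ} (hU : Uᴴ * U = 1)
    (B : Matrix ι ι ℂ) : ∑ i, ∑ j, ‖(U * B) i j‖ ^ 2 = ∑ i, ∑ j, ‖B i j‖ ^ 2 := by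
  rw [Finset.sum_comm, Finset.sum_comm (f := fun i j => ‖B i j‖ ^ 2)]
  exact Finset.sum_congr rfl fun j _ => sum_norm_sq_mulVec_of_unitary hU fun i => B i j

theorem Matrix.sum_norm_sq_conjTranspose {ι : Type*} [Fintype ι] (B : Matrix ι ι ℂ) :
    ∑ i, ∑ j, ‖Bᴴ i j‖ ^ 2 = ∑ i, ∑ j, ‖B i j‖ ^ 2 := by
  rw [Finset.sum_comm]
  simp

theorem Matrix.sum_norm_sq_unitary_diagonal {U : Matrix ι ι ℂ} (hU : Uᴴ * U = 1)
    (f : ι → ℝ) :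
    ∑ i, ∑ j, ‖(U * diagonal (fun a => (f a : ℂ)) * Uᴴ) i j‖ ^ 2 = ∑ a, f a ^ 2 := by
  rw [mul_assoc, sum_norm_sq_unitary_mul hU, ← sum_norm_sq_conjTranspose, conjTranspose_mul,
    conjTranspose_conjTranspose, sum_norm_sq_unitary_mul hU, sum_norm_sq_conjTranspose]
  refine Finset.sum_congr rfl fun i _ => ?_
  rw [Finset.sum_eq_single i] <;> simp +contextual [eq_comm]

theorem Matrix.opLe_unitary_diagonal {U : Matrix ι ι ℂ} (hU : Uᴴ * U = 1)
    {f : ι → ℝ} {c : ℝ} (hf : ∀ a, |f a| ≤ c) :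
    (U * diagonal (fun a => (f a : ℂ)) * Uᴴ).OpLe c := by
  intro w
  have hU' : Uᴴᴴ * Uᴴ = 1 := by
    rw [conjTranspose_conjTranspose]; exact mul_eq_one_comm.1 hU
  rw [mul_assoc, ← mulVec_mulVec, sum_norm_sq_mulVec_of_unitary hU, ← mulVec_mulVec,
    ← sum_norm_sq_mulVec_of_unitary hU' w, Finset.mul_sum]
  refine Finset.sum_le_sum fun i _ => ?_
  rw [mulVec_diagonal, norm_mul, mul_pow, Complex.norm_real, Real.norm_eq_abs]
  have := hf i
  gcongr

theorem Matrix.unitary_diagonal_eq_sum (U : Matrix ι ι ℂ) (f : ι → ℝ) :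
    U * diagonal (fun a => (f a : ℂ)) * Uᴴ
      = ∑ a, (f a : ℂ) • vecMulVec (fun i => U i a) (star fun i => U i a) := by
  ext i j
  rw [Matrix.sum_apply, mul_apply]
  refine Finset.sum_congr rfl fun a _ => ?_
  simp only [mul_diagonal, conjTranspose_apply, Matrix.smul_apply, vecMulVec_apply, smul_eq_mul,
    Pi.star_apply]
  ring

theorem Matrix.isFlat_unitary_diagonal {N r : ℕ} {U : Matrix (Fin N) (Fin N) ℂ}
    (hU : Uᴴ * U = 1) {f : Fin N → ℝ} {S : Finset (Fin N)} (hS : S.card ≤ r)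
    (hf0 : ∀ a ∉ S, f a = 0) (hf : ∀ a, |f a| ≤ 1 / √r) :
    (U * diagonal (fun a => (f a : ℂ)) * Uᴴ).IsFlat r where
  isHermitian := by
    rw [Matrix.IsHermitian, conjTranspose_mul, conjTranspose_mul, conjTranspose_conjTranspose,
      diagonal_conjTranspose, mul_assoc]
    congr 3
    ext a
    simp
  opLe := opLe_unitary_diagonal hU hf
  frob := by
    rw [sum_norm_sq_unitary_diagonal hU]
    have h1 : ∑ a, f a ^ 2 = ∑ a ∈ S, f a ^ 2 :=
      (Finset.sum_subset (Finset.subset_univ S) fun a _ ha => by rw [hf0 a ha]; simp).symm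
    rw [h1]
    calc ∑ a ∈ S, f a ^ 2 ≤ ∑ a ∈ S, (1 / √(r : ℝ)) ^ 2 := by
          refine Finset.sum_le_sum fun a _ => ?_
          rw [← sq_abs]
          have := hf a
          gcongr
      _ = S.card * (1 / (r : ℝ)) := by simp [Real.sq_sqrt]
      _ ≤ r * (1 / (r : ℝ)) := by gcongr
      _ ≤ 1 := by rw [mul_one_div]; exact div_self_le_one _
  decomp := by
    -- The decomposition must be indexed by `Fin r` even when `S` is smaller, so the eigenpairs in
    -- `S` are embedded and padded with zeros.
    have hemb : Nonempty (S ↪ Fin r) :=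
      Function.Embedding.nonempty_of_card_le (by simpa using hS)
    obtain ⟨e⟩ := hemb
    refine ⟨Function.extend e (fun a : S => f a) 0,
      Function.extend e (fun a : S => fun i => U i a) 0, fun b => ?_, fun b => ?_, ?_⟩
    · by_cases hb : ∃ a, e a = b
      · obtain ⟨a, rfl⟩ := hb
        rw [e.injective.extend_apply]
        exact hf a
      · rw [Function.extend_apply' _ _ _ hb]
        simp
    · by_cases hb : ∃ a, e a = b
      · obtain ⟨a, rfl⟩ := hb
        rw [e.injective.extend_apply]
        have h := congrFun (congrFun hU a) a
        rw [mul_apply, one_apply_eq] at h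
        have h2 : ((∑ i, ‖U i a‖ ^ 2 : ℝ) : ℂ) = 1 := by
          rw [← h, Complex.ofReal_sum]
          refine Finset.sum_congr rfl fun i _ => ?_
          rw [Complex.ofReal_pow, ← Complex.conj_mul']; rfl
        exact le_of_eq (by exact_mod_cast h2)
      · rw [Function.extend_apply' _ _ _ hb]
        simp
    · rw [unitary_diagonal_eq_sum, ← Finset.sum_subset (Finset.subset_univ S)
        fun a _ ha => by rw [hf0 a ha]; simp, ← Finset.sum_coe_sort S]
      refine Finset.sum_of_injOn e e.injective.injOn (by simp) (fun b _ hb => ?_) fun a _ => ?_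
      · rw [Function.extend_apply' _ _ _ (by simpa using hb)]
        simp
      · rw [e.injective.extend_apply, e.injective.extend_apply]

theorem PairTensor.sum_norm_sq_le_of_mem_hermBall {N : ℕ} {X : Matrix (Fin N) (Fin N) ℂ}
    (hX : X ∈ PairTensor.hermBall N) : ∑ i, ∑ j, ‖X i j‖ ^ 2 ≤ 1 := by
  have h := hX.2
  rw [frobenius_norm_def, ← Real.sqrt_eq_rpow, Real.sqrt_le_iff] at h
  simpa using h.2

/-- The level is the largest `k ≤ K` with `|x| ≤ 2⁻ᵏ`. Either `2⁻ᵏ < 2|x|`, or `k = K` and the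
truncation term `4⁻ᴷ` pays. -/
theorem exists_level {K : ℕ} {x : ℝ} (hx : |x| ≤ 1) :
    ∃ k : Fin (K + 1), |x| ≤ (1 / 2) ^ (k : ℕ) ∧
      ((1 / 2 : ℝ) ^ (k : ℕ)) ^ 2 ≤ 4 * x ^ 2 + (1 / 4) ^ K := by
  classical
  set k := Nat.findGreatest (fun k => |x| ≤ (1 / 2 : ℝ) ^ k) K with hk
  have hkK : k ≤ K := Nat.findGreatest_le K
  have h1 : |x| ≤ (1 / 2 : ℝ) ^ k :=
    Nat.findGreatest_spec (P := fun k => |x| ≤ (1 / 2 : ℝ) ^ k) (Nat.zero_le K) (by simpa using hx)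
  refine ⟨⟨k, Nat.lt_succ_of_le hkK⟩, h1, ?_⟩
  rcases hkK.eq_or_lt with h | h
  · simp only [h]
    rw [← pow_mul, mul_comm, pow_mul]
    norm_num
    positivity
  · have h2 := Nat.findGreatest_is_greatest (P := fun k => |x| ≤ (1 / 2 : ℝ) ^ k)
      (Nat.lt_succ_self k) h
    have h3 : (1 / 2 : ℝ) ^ k ≤ 2 * |x| := by
      rw [not_le, pow_succ] at h2
      linarith
    have h4 : ((1 / 2 : ℝ) ^ k) ^ 2 ≤ (2 * |x|) ^ 2 := by gcongr
    rw [mul_pow, sq_abs] at h4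
    have : (0 : ℝ) < (1 / 4) ^ K := by positivity
    simp only
    linarith

theorem exists_flat_decomposition {N K : ℕ} (hN : 1 ≤ N) (hK : N ≤ 4 ^ K)
    {X : Matrix (Fin N) (Fin N) ℂ} (hX : X ∈ PairTensor.hermBall N) :
    ∃ (c : Fin (K + 1) → ℝ) (r : Fin (K + 1) → ℕ)
      (Y : Fin (K + 1) → Matrix (Fin N) (Fin N) ℂ),
      (∀ k, 0 ≤ c k) ∧ (∀ k, 1 ≤ r k ∧ r k ≤ N) ∧ (∀ k, (Y k).IsFlat (r k)) ∧
        X = ∑ k, (c k : ℂ) • Y k ∧ ∑ k, c k ^ 2 ≤ 7 := by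
  classical
  set l := hX.1.eigenvalues with hl
  set U : Matrix (Fin N) (Fin N) ℂ := (hX.1.eigenvectorUnitary : Matrix (Fin N) (Fin N) ℂ) with hUd
  have hU : Uᴴ * U = 1 := by
    have := Unitary.coe_star_mul_self hX.1.eigenvectorUnitary
    simpa [star_eq_conjTranspose] using this
  have hXU : X = U * diagonal (fun a => (l a : ℂ)) * Uᴴ := by
    have := hX.1.spectral_theorem
    rw [Unitary.conjStarAlgAut_apply] at this
    exact this
  have hl2 : ∑ a, l a ^ 2 ≤ 1 := by
    rw [← sum_norm_sq_unitary_diagonal hU, ← hXU]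
    exact PairTensor.sum_norm_sq_le_of_mem_hermBall hX
  have hl1 : ∀ a, |l a| ≤ 1 := by
    intro a
    have h1 := (Finset.single_le_sum (f := fun k => l k ^ 2) (fun k _ => by positivity)
      (Finset.mem_univ a)).trans hl2
    exact (sq_le_one_iff_abs_le_one _).1 h1
  choose lev hlev1 hlev2 using fun a => exists_level (K := K) (hl1 a)
  set S : Fin (K + 1) → Finset (Fin N) := fun k => Finset.univ.filter fun a => lev a = k with hS
  -- The maximum with `1` gives empty levels a positive rank, so that `c k` is nonzero; this costs
  -- `∑ 4⁻ᵏ ≤ 2` in the coefficient sum.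
  set r : Fin (K + 1) → ℕ := fun k => max 1 (S k).card with hr
  set c : Fin (K + 1) → ℝ := fun k => (1 / 2) ^ (k : ℕ) * √(r k) with hc
  have hrpos : ∀ k, (0 : ℝ) < r k := fun k => by
    exact_mod_cast lt_of_lt_of_le one_pos (le_max_left _ _)
  have hcpos : ∀ k, 0 < c k := fun k => mul_pos (by positivity) (Real.sqrt_pos.2 (hrpos k))
  set f : Fin (K + 1) → Fin N → ℝ := fun k a => if lev a = k then l a / c k else 0 with hf
  refine ⟨c, r, fun k => U * diagonal (fun a => (f k a : ℂ)) * Uᴴ, fun k => (hcpos k).le,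
    fun k => ⟨le_max_left _ _, max_le hN ?_⟩, fun k => ?_, ?_, ?_⟩
  · exact (Finset.card_le_univ _).trans_eq (by simp)
  · refine isFlat_unitary_diagonal hU (S := S k) (le_max_right _ _) (fun a ha => ?_) fun a => ?_
    · have : lev a ≠ k := by simpa [hS] using ha
      simp [hf, this]
    · by_cases h : lev a = k
      · have h1 := hlev1 a
        rw [h] at h1
        have h2 : f k a = l a / c k := by simp [hf, h]
        rw [h2, abs_div, abs_of_pos (hcpos k), div_le_div_iff₀ (hcpos k)
          (Real.sqrt_pos.2 (hrpos k)), one_mul]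
        exact mul_le_mul_of_nonneg_right h1 (Real.sqrt_nonneg _)
      · have h2 : f k a = 0 := by simp [hf, h]
        rw [h2, abs_zero]
        positivity
  · have h1 : ∀ a, (l a : ℂ) = ∑ k, (c k : ℂ) * (f k a : ℂ) := by
      intro a
      rw [Finset.sum_eq_single (lev a)]
      · have : c (lev a) ≠ 0 := (hcpos _).ne'
        have h2 : l a = c (lev a) * f (lev a) a := by
          simp only [hf, if_true]; field_simp
        exact_mod_cast h2
      · intro k _ hk
        simp [hf, hk.symm]
      · simp
    conv_lhs => rw [hXU]
    have h2 : diagonal (fun a => (l a : ℂ))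
        = ∑ k, (c k : ℂ) • diagonal (fun a => (f k a : ℂ)) := by
      ext i j
      by_cases hij : i = j
      · subst hij; simp [h1, Matrix.sum_apply]
      · simp [hij, Matrix.sum_apply]
    rw [h2, Finset.mul_sum, Finset.sum_mul]
    exact Finset.sum_congr rfl fun k _ => by rw [mul_smul_comm, smul_mul_assoc]
  · have h1 : ∀ k, c k ^ 2 ≤ (1 / 4 : ℝ) ^ (k : ℕ)
        + ∑ a, if lev a = k then ((1 / 2 : ℝ) ^ (lev a : ℕ)) ^ 2 else 0 := by
      intro k
      have h2 : ∑ a, (if lev a = k then ((1 / 2 : ℝ) ^ (lev a : ℕ)) ^ 2 else 0)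
          = (S k).card * (1 / 4 : ℝ) ^ (k : ℕ) := by
        rw [← Finset.sum_filter, ← nsmul_eq_mul]
        refine Finset.sum_eq_card_nsmul fun a ha => ?_
        rw [(Finset.mem_filter.1 ha).2, ← pow_mul, mul_comm, pow_mul]
        norm_num
      have h3 : c k ^ 2 = (1 / 4 : ℝ) ^ (k : ℕ) * r k := by
        simp only [hc]
        rw [mul_pow, Real.sq_sqrt (hrpos k).le, ← pow_mul, mul_comm (k : ℕ), pow_mul]
        norm_num
      have h4 : (r k : ℝ) ≤ 1 + (S k).card := by
        have : r k ≤ 1 + (S k).card := max_le (by omega) (by omega)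
        exact_mod_cast this
      have h5 : (0 : ℝ) < (1 / 4) ^ (k : ℕ) := by positivity
      rw [h2, h3]
      nlinarith
    have h6 : ∑ k : Fin (K + 1), (1 / 4 : ℝ) ^ (k : ℕ) ≤ 2 := by
      rw [Fin.sum_univ_eq_sum_range (fun k => (1 / 4 : ℝ) ^ k) (K + 1), geom_sum_eq (by norm_num)]
      have : (0 : ℝ) < (1 / 4) ^ (K + 1) := by positivity
      rw [div_le_iff_of_neg (by norm_num)]
      linarith
    have h7 : (N : ℝ) * (1 / 4) ^ K ≤ 1 := by
      rw [one_div, inv_pow, ← div_eq_mul_inv, div_le_one (by positivity)]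
      exact_mod_cast hK
    -- The `7` is `2` from the padded ranks, `4` from the Frobenius norm, and `1` from truncation,
    -- where `N ≤ 4 ^ K` is used.
    calc ∑ k, c k ^ 2 ≤ ∑ k : Fin (K + 1), ((1 / 4 : ℝ) ^ (k : ℕ)
          + ∑ a, if lev a = k then ((1 / 2 : ℝ) ^ (lev a : ℕ)) ^ 2 else 0) :=
          Finset.sum_le_sum fun k _ => h1 k
      _ = ∑ k : Fin (K + 1), (1 / 4 : ℝ) ^ (k : ℕ) + ∑ a, ((1 / 2 : ℝ) ^ (lev a : ℕ)) ^ 2 := by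
          rw [Finset.sum_add_distrib, Finset.sum_comm (s := Finset.univ (α := Fin (K + 1)))]
          simp
      _ ≤ 2 + ∑ a, (4 * l a ^ 2 + (1 / 4) ^ K) :=
          add_le_add h6 (Finset.sum_le_sum fun a _ => hlev2 a)
      _ = 2 + (4 * ∑ a, l a ^ 2 + N * (1 / 4) ^ K) := by
          rw [Finset.sum_add_distrib, Finset.mul_sum]; simp
      _ ≤ 7 := by linarith

end Spectral

/-! ### Union bound. -/

section Union

theorem measureReal_exists_le {Ω α : Type*} [MeasurableSpace Ω] {μ : Measure Ω}
    [IsFiniteMeasure μ] (R : Finset α) {P : α → Ω → Prop} {b : ℝ}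
    (h : ∀ x ∈ R, μ.real {ω | P x ω} ≤ b) : μ.real {ω | ∃ x ∈ R, P x ω} ≤ R.card * b := by
  have h1 : {ω | ∃ x ∈ R, P x ω} = ⋃ x ∈ R, {ω | P x ω} := by
    ext ω; simp
  rw [h1]
  refine (measureReal_biUnion_finset_le R _).trans ?_
  rw [← nsmul_eq_mul]
  exact Finset.sum_le_card_nsmul R _ b h

end Union

/-! ### Passing from nets to all matrices and vectors. -/

section Perturbation

variable {N : ℕ}

theorem Matrix.norm_apply_le_one_of_frob {X : Matrix (Fin N) (Fin N) ℂ}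
    (h : ∑ i, ∑ j, ‖X i j‖ ^ 2 ≤ 1) (i j : Fin N) : ‖X i j‖ ≤ 1 := by
  refine norm_le_one_of_sum_sq_le (x := fun p : Fin N × Fin N => X p.1 p.2) ?_ (i, j)
  rwa [Fintype.sum_prod_type]

/-- A crude `ℓ¹` bound suffices: the mesh may be any inverse power of `N`, as only the logarithm of
the net size matters. -/
theorem quadForm₃_sub_le {g : Triple N → ℝ} {G e : ℝ} (hG : ∑ p, |g p| ≤ G)
    {X Y Z X' Y' Z' : Matrix (Fin N) (Fin N) ℂ} (hY : ∀ i j, ‖Y i j‖ ≤ 1)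
    (hZ : ∀ i j, ‖Z i j‖ ≤ 1) (hX' : ∀ i j, ‖X' i j‖ ≤ 1) (hY' : ∀ i j, ‖Y' i j‖ ≤ 1)
    (hXX : ∀ i j, ‖X i j - X' i j‖ ≤ e) (hYY : ∀ i j, ‖Y i j - Y' i j‖ ≤ e)
    (hZZ : ∀ i j, ‖Z i j - Z' i j‖ ≤ e) (he : 0 ≤ e) :
    ‖quadForm₃ g X Y Z - quadForm₃ g X' Y' Z'‖ ≤ G ^ 2 * (3 * e) := by
  simp only [quadForm₃, ← Finset.sum_sub_distrib, ← mul_sub]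
  calc _ ≤ ∑ p, ∑ q, |g p| * |g q| * (3 * e) := by
        refine norm_sum_le_of_le _ fun p _ => norm_sum_le_of_le _ fun q _ => ?_
        rw [norm_mul, Complex.norm_real, Real.norm_eq_abs, abs_mul]
        refine mul_le_mul_of_nonneg_left ?_ (by positivity)
        simp only [kroneckerMap_apply, ← mul_assoc]
        refine (norm_mul₃_sub_le (hY _ _) (hZ _ _) (hX' _ _) (hY' _ _)).trans ?_
        linarith [hXX p.1 q.1, hYY p.2.1 q.2.1, hZZ p.2.2 q.2.2]
    _ = (∑ p, |g p|) ^ 2 * (3 * e) := by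
        rw [pow_two, Finset.sum_mul_sum, Finset.sum_mul]
        exact Finset.sum_congr rfl fun p _ => by rw [Finset.sum_mul]
    _ ≤ _ := by gcongr

theorem Matrix.norm_offDiag_sub_le {X X' : Matrix (Fin N) (Fin N) ℂ} {e : ℝ} (he : 0 ≤ e)
    (h : ∀ i j, ‖X i j - X' i j‖ ≤ e) (i j : Fin N) :
    ‖X.offDiag i j - X'.offDiag i j‖ ≤ e := by
  simp only [offDiag_apply]
  split_ifs
  · simpa using he
  · exact h i j

theorem sum_abs_le_of_abs_le {g : Triple N → ℝ} (hg : ∀ p, |g p| ≤ N) :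
    ∑ p, |g p| ≤ (N : ℝ) ^ 4 := by
  calc ∑ p, |g p| ≤ ∑ _p : Triple N, (N : ℝ) := Finset.sum_le_sum fun p _ => hg p
    _ = (N : ℝ) ^ 4 := by simp; ring

theorem sum_norm_sq_smul_inv {x : Fin N → ℂ} (h : 0 < ∑ i, ‖x i‖ ^ 2) :
    ∑ i, ‖(((√(∑ i, ‖x i‖ ^ 2))⁻¹ : ℝ) : ℂ) * x i‖ ^ 2 ≤ 1 := by
  simp only [norm_mul, mul_pow, Complex.norm_real, norm_inv, Real.norm_eq_abs, sq_abs, inv_pow]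
  rw [← Finset.mul_sum, Real.sq_sqrt h.le, inv_mul_cancel₀ h.ne']

theorem injLe_of_ball {g : Triple N → ℝ} {B : ℝ}
    (h : ∀ x y z : Fin N → ℂ, ∑ i, ‖x i‖ ^ 2 ≤ 1 → ∑ i, ‖y i‖ ^ 2 ≤ 1 → ∑ i, ‖z i‖ ^ 2 ≤ 1 →
      ‖∑ p : Triple N, (g p : ℂ) * (x p.1 * (y p.2.1 * z p.2.2))‖ ^ 2 ≤ B) : InjLe g B := by
  have hzero : ∀ x : Fin N → ℂ, ¬ 0 < ∑ i, ‖x i‖ ^ 2 → ∀ i, x i = 0 := by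
    intro x hx i
    have h0 : ∑ i, ‖x i‖ ^ 2 = 0 := le_antisymm (not_lt.1 hx) (by positivity)
    have := (Finset.sum_eq_zero_iff_of_nonneg (fun i _ => by positivity)).1 h0 i
      (Finset.mem_univ i)
    simpa using this
  have hB : 0 ≤ B := (sq_nonneg _).trans (h 0 0 0 (by simp) (by simp) (by simp))
  intro x y z
  by_cases hx : 0 < ∑ i, ‖x i‖ ^ 2
  swap
  · simp only [hzero x hx, zero_mul, mul_zero, Finset.sum_const_zero, norm_zero,
      zero_pow two_ne_zero]
    positivity
  by_cases hy : 0 < ∑ i, ‖y i‖ ^ 2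
  swap
  · simp only [hzero y hy, zero_mul, mul_zero, Finset.sum_const_zero, norm_zero,
      zero_pow two_ne_zero]
    positivity
  by_cases hz : 0 < ∑ i, ‖z i‖ ^ 2
  swap
  · simp only [hzero z hz, mul_zero, Finset.sum_const_zero, norm_zero,
      zero_pow two_ne_zero]
    positivity
  have h1 := h _ _ _ (sum_norm_sq_smul_inv hx) (sum_norm_sq_smul_inv hy) (sum_norm_sq_smul_inv hz)
  set a := ∑ i, ‖x i‖ ^ 2
  set b := ∑ i, ‖y i‖ ^ 2
  set c := ∑ i, ‖z i‖ ^ 2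
  have h2 : ∑ p : Triple N, (g p : ℂ) * (((√a)⁻¹ : ℝ) * x p.1 * (((√b)⁻¹ : ℝ) * y p.2.1
      * (((√c)⁻¹ : ℝ) * z p.2.2))) = (((√a)⁻¹ * (√b)⁻¹ * (√c)⁻¹ : ℝ) : ℂ)
        * ∑ p : Triple N, (g p : ℂ) * (x p.1 * (y p.2.1 * z p.2.2)) := by
    rw [Finset.mul_sum]
    refine Finset.sum_congr rfl fun p _ => ?_
    push_cast
    ring
  rw [h2, norm_mul, mul_pow, Complex.norm_real, Real.norm_eq_abs, sq_abs, mul_pow, mul_pow,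
    inv_pow, inv_pow, inv_pow, Real.sq_sqrt hx.le, Real.sq_sqrt hy.le, Real.sq_sqrt hz.le] at h1
  calc _ = (a * (b * c)) * (a⁻¹ * b⁻¹ * c⁻¹
        * ‖∑ p : Triple N, (g p : ℂ) * (x p.1 * (y p.2.1 * z p.2.2))‖ ^ 2) := by
        field_simp
    _ ≤ (a * (b * c)) * B := by gcongr
    _ = _ := by ring

end Perturbation

/-! ### High-probability bounds on injective norm and flat triples. -/

section Estimates

variable {N : ℕ}

theorem two_le_log_of_le (hN : 30 ≤ N) : 2 ≤ Real.log N := by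
  have hN' : (30 : ℝ) ≤ N := by exact_mod_cast hN
  rw [Real.le_log_iff_exp_le (by linarith)]
  have h1 : Real.exp 2 = Real.exp 1 ^ 2 := by rw [← Real.exp_nat_mul]; norm_num
  have h2 := Real.exp_one_lt_d9
  have h3 := Real.exp_pos 1
  rw [h1]
  nlinarith

theorem net_card_le_exp (hN : 30 ≤ N) (k : ℕ) :
    (((2 * N ^ 10 + 1) ^ k : ℕ) : ℝ) ≤ Real.exp (11 * Real.log N * k) := by
  have hN' : (30 : ℝ) ≤ N := by exact_mod_cast hN
  have h1 : Real.exp (11 * Real.log N * k) = ((N : ℝ) ^ 11) ^ k := by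
    rw [mul_comm, Real.exp_nat_mul, mul_comm, ← Real.exp_log (x := (N : ℝ) ^ 11) (by positivity),
      Real.log_pow]
    congr 2
    push_cast
    ring
  rw [h1]
  push_cast
  have h2 : 2 * (N : ℝ) ^ 10 + 1 ≤ (N : ℝ) ^ 11 := by
    have h3 : (1 : ℝ) ≤ (N : ℝ) ^ 10 := one_le_pow₀ (by linarith)
    rw [pow_succ _ 10]
    nlinarith
  gcongr

theorem stdNormalLaw_exists_large_entry (hN : 30 ≤ N) :
    (stdNormalLaw (Triple N)).real {g | ¬ ∀ p, |g p| ≤ N} ≤ Real.exp (-(2 * N)) := by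
  have hN' : (30 : ℝ) ≤ N := by exact_mod_cast hN
  have h := measureReal_exists_le (μ := stdNormalLaw (Triple N)) (Finset.univ : Finset (Triple N))
    (P := fun p g => (N : ℝ) ^ 2 ≤ ‖∑ q, (g q : ℂ) * (Pi.single p 1 : Triple N → ℂ) q‖ ^ 2)
    fun p _ => stdNormalLaw_linear_tail (c := Pi.single p 1)
      (by rw [Finset.sum_eq_single p] <;> simp +contextual) _
  calc _ ≤ _ := measureReal_mono (fun g hg => ?_)
    _ ≤ _ := h
    _ ≤ _ := ?_
  · simp only [Set.mem_ofPred_eq, not_forall, not_le] at hg ⊢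
    obtain ⟨p, hp⟩ := hg
    refine ⟨p, Finset.mem_univ p, ?_⟩
    rw [Finset.sum_eq_single p (fun q _ hq => by simp [hq]) (by simp)]
    simp only [Pi.single_eq_same, mul_one, Complex.norm_real, Real.norm_eq_abs]
    gcongr
  · have h1 : ((Finset.univ : Finset (Triple N)).card : ℝ) ≤ Real.exp (3 * N) := by
      have h2 : (N : ℝ) ≤ Real.exp N := by linarith [Real.add_one_le_exp (N : ℝ)]
      have h3 : ((Finset.univ : Finset (Triple N)).card : ℝ) = (N : ℝ) ^ 3 := by simp; ring
      rw [h3, show (3 : ℝ) * N = ((3 : ℕ) : ℝ) * N by norm_num, Real.exp_nat_mul]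
      gcongr
    calc _ ≤ Real.exp (3 * N) * Real.exp (-((N : ℝ) ^ 2 / 4) + 3 / 8) := by gcongr
      _ ≤ _ := by
        rw [← Real.exp_add]
        apply Real.exp_le_exp.2
        nlinarith

theorem stdNormalLaw_not_injLe (hN : 30 ≤ N) :
    (stdNormalLaw (Triple N)).real
        {g | (∀ p, |g p| ≤ N) ∧ ¬ InjLe g (1200 * (N * Real.log N))}
      ≤ Real.exp (-(8 * (N * Real.log N))) := by
  have hN' : (30 : ℝ) ≤ N := by exact_mod_cast hN
  have hL := two_le_log_of_le hN
  set L := Real.log N with hLd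
  have hM : 0 < N ^ 10 := by positivity
  obtain ⟨R, hR, hRb, hRn⟩ := exists_ball_net N hM
  have hnorm : ∀ x y z : Fin N → ℂ, ∑ p : Triple N, ‖x p.1 * (y p.2.1 * z p.2.2)‖ ^ 2
      = (∑ i, ‖x i‖ ^ 2) * ((∑ i, ‖y i‖ ^ 2) * ∑ i, ‖z i‖ ^ 2) := by
    intro x y z
    simp only [Fintype.sum_prod_type, norm_mul, mul_pow]
    simp only [Finset.sum_mul_sum, ← Finset.mul_sum]
  have h := measureReal_exists_le (μ := stdNormalLaw (Triple N)) (R ×ˢ R ×ˢ R)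
    (P := fun τ g => 300 * (N * L)
      ≤ ‖∑ p : Triple N, (g p : ℂ) * (τ.1 p.1 * (τ.2.1 p.2.1 * τ.2.2 p.2.2))‖ ^ 2)
    (b := Real.exp (-(300 * (N * L) / 4) + 3 / 8))
    -- The net of triples has size at most `exp(66 N log N)`, against a tail of exponent `75 N log N
    -- - 3/8`.
    (fun τ hτ => by
      simp only [Finset.mem_product] at hτ
      refine stdNormalLaw_linear_tail
        (c := fun p : Triple N => τ.1 p.1 * (τ.2.1 p.2.1 * τ.2.2 p.2.2)) ?_ _
      rw [hnorm]
      have h1 := hRb _ hτ.1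
      have h2 := hRb _ hτ.2.1
      have h3 := hRb _ hτ.2.2
      exact mul_le_one₀ h1 (by positivity) (mul_le_one₀ h2 (by positivity) h3))
  calc _ ≤ _ := measureReal_mono (fun g hg => ?_)
    _ ≤ _ := h
    _ ≤ _ := ?_
  · obtain ⟨hg1, hg2⟩ := hg
    simp only [Set.mem_ofPred_eq]
    by_contra hcon
    push Not at hcon
    refine hg2 (injLe_of_ball fun x y z hx hy hz => ?_)
    obtain ⟨x', hx', hxx⟩ := hRn x hx
    obtain ⟨y', hy', hyy⟩ := hRn y hy
    obtain ⟨z', hz', hzz⟩ := hRn z hz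
    have h1 := hcon (x', y', z') (by simp [hx', hy', hz'])
    simp only at h1
    have h2 : ‖∑ p : Triple N, (g p : ℂ) * (x p.1 * (y p.2.1 * z p.2.2))
        - ∑ p : Triple N, (g p : ℂ) * (x' p.1 * (y' p.2.1 * z' p.2.2))‖ ≤ 1 := by
      rw [← Finset.sum_sub_distrib]
      calc _ ≤ ∑ p, |g p| * (6 * (1 / (N ^ 10 : ℕ))) := by
            refine norm_sum_le_of_le _ fun p _ => ?_
            rw [← mul_sub, norm_mul, Complex.norm_real, Real.norm_eq_abs]
            refine mul_le_mul_of_nonneg_left ?_ (abs_nonneg _)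
            simp only [← mul_assoc]
            refine (norm_mul₃_sub_le (norm_le_one_of_sum_sq_le hy _)
              (norm_le_one_of_sum_sq_le hz _) (norm_le_one_of_sum_sq_le (hRb _ hx') _)
              (norm_le_one_of_sum_sq_le (hRb _ hy') _)).trans ?_
            linarith [hxx p.1, hyy p.2.1, hzz p.2.2]
        _ ≤ (N : ℝ) ^ 4 * (6 * (1 / (N ^ 10 : ℕ))) := by
            rw [← Finset.sum_mul]
            exact mul_le_mul_of_nonneg_right (sum_abs_le_of_abs_le hg1) (by positivity)
        _ = 6 / (N : ℝ) ^ 6 := by push_cast; field_simp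
        _ ≤ 1 := by
            rw [div_le_one (by positivity)]
            calc (6 : ℝ) ≤ N := by linarith
              _ ≤ (N : ℝ) ^ 6 := le_self_pow₀ (by linarith) (by norm_num)
    set F := ∑ p : Triple N, (g p : ℂ) * (x p.1 * (y p.2.1 * z p.2.2))
    set F' := ∑ p : Triple N, (g p : ℂ) * (x' p.1 * (y' p.2.1 * z' p.2.2))
    have h3 : ‖F‖ ≤ ‖F'‖ + 1 := by
      have := norm_sub_norm_le F F'
      linarith
    have h4 : ‖F‖ ^ 2 ≤ (‖F'‖ + 1) ^ 2 := by gcongr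
    nlinarith [sq_nonneg (‖F'‖ - 1)]
  · have hcard : ((R ×ˢ R ×ˢ R).card : ℝ) ≤ Real.exp (11 * L * (6 * N : ℕ)) := by
      refine le_trans ?_ (net_card_le_exp hN (6 * N))
      have h1 : (R ×ˢ R ×ˢ R).card ≤ (2 * N ^ 10 + 1) ^ (6 * N) := by
        rw [Finset.card_product, Finset.card_product]
        calc R.card * (R.card * R.card) ≤ (2 * N ^ 10 + 1) ^ (2 * N) *
              ((2 * N ^ 10 + 1) ^ (2 * N) * (2 * N ^ 10 + 1) ^ (2 * N)) := by gcongr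
          _ = _ := by rw [← pow_add, ← pow_add]; congr 1; ring
      exact_mod_cast h1
    calc _ ≤ Real.exp (11 * L * (6 * N : ℕ)) * Real.exp (-(300 * (N * L) / 4) + 3 / 8) := by gcongr
      _ ≤ _ := by
        rw [← Real.exp_add]
        apply Real.exp_le_exp.2
        push_cast
        nlinarith

theorem stdNormalLaw_flat_net_tail {r s t : ℕ} (hN : 30 ≤ N) (hr : 1 ≤ r ∧ r ≤ N)
    (hs : 1 ≤ s ∧ s ≤ N) (ht : 1 ≤ t ∧ t ≤ N) (hrst : r ≤ s * t) (hstr : s ≤ t * r)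
    (htrs : t ≤ r * s) :
    (stdNormalLaw (Triple N)).real
        {g | (∀ p, |g p| ≤ N) ∧ ∃ X Y Z : Matrix (Fin N) (Fin N) ℂ, X.IsFlat r ∧ Y.IsFlat s ∧
          Z.IsFlat t ∧ 3520 * (N * Real.log N) + 1
            < ‖quadForm₃ g X.offDiag Y.offDiag Z.offDiag‖}
      ≤ Real.exp (-(10 * (N * Real.log N))) := by
  have hN' : (30 : ℝ) ≤ N := by exact_mod_cast hN
  have hL := two_le_log_of_le hN
  set L := Real.log N with hLd
  have hM : 0 < N ^ 10 := by positivity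
  obtain ⟨R₁, hR₁, hRf₁, hRn₁⟩ := exists_flat_net hM hr.1 hr.2
  obtain ⟨R₂, hR₂, hRf₂, hRn₂⟩ := exists_flat_net hM hs.1 hs.2
  obtain ⟨R₃, hR₃, hRf₃, hRn₃⟩ := exists_flat_net hM ht.1 ht.2
  -- The balance hypotheses enter only here: the largest rank is at most the product of the other
  -- two, so its square is at most `rst`.
  obtain ⟨m, hm1, hmN, hrm, hsm, htm, hm2⟩ : ∃ m : ℕ, 1 ≤ m ∧ m ≤ N ∧ r ≤ m ∧ s ≤ m ∧ t ≤ m ∧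
      m ^ 2 ≤ r * (s * t) := by
    refine ⟨max r (max s t), by omega, by omega, by omega, by omega, by omega, ?_⟩
    rcases max_choice r (max s t) with h | h
    · rw [h, pow_two]; exact Nat.mul_le_mul_left r hrst
    · rcases max_choice s t with h' | h'
      · rw [h, h']; nlinarith
      · rw [h, h']; nlinarith
  have hm1' : (1 : ℝ) ≤ m := by exact_mod_cast hm1
  have hmN' : (m : ℝ) ≤ N := by exact_mod_cast hmN
  have hsq : (m : ℝ) ≤ √r * (√s * √t) := by
    rw [← Real.sqrt_mul (by positivity), ← Real.sqrt_mul (by positivity)]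
    apply Real.le_sqrt_of_sq_le
    exact_mod_cast hm2
  have hfrob : ∀ {k : ℕ} {X : Matrix (Fin N) (Fin N) ℂ}, X.IsFlat k →
      ∑ i, ∑ j, ‖X.offDiag i j‖ ^ 2 ≤ 1 := fun hX =>
    (Finset.sum_le_sum fun i _ => Finset.sum_le_sum fun j _ =>
      pow_le_pow_left₀ (norm_nonneg _) (norm_offDiag_apply_le _ i j) 2).trans hX.frob
  have hent : ∀ {k : ℕ} {X : Matrix (Fin N) (Fin N) ℂ}, X.IsFlat k →
      ∀ i j, ‖X.offDiag i j‖ ≤ 1 := fun hX => norm_apply_le_one_of_frob (hfrob hX)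
  have h := measureReal_exists_le (μ := stdNormalLaw (Triple N)) (R₁ ×ˢ R₂ ×ˢ R₃)
    (P := fun τ g => 3520 * (N * L) ≤ ‖quadForm₃ g τ.1.offDiag τ.2.1.offDiag τ.2.2.offDiag‖)
    -- The operator norm is at most `a = 8/√(rst)`, so the rate `s = m/32` satisfies `4as = m/√(rst)
    -- ≤ 1`.
    (b := 2 * Real.exp (-((m / 32) * (3520 * (N * L))) + 2 * (m / 32 : ℝ) ^ 2))
    (fun τ hτ => by
      simp only [Finset.mem_product] at hτ
      have hX := hRf₁ _ hτ.1
      have hY := hRf₂ _ hτ.2.1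
      have hZ := hRf₃ _ hτ.2.2
      refine stdNormalLaw_hermitian_tail
        (hX.isHermitian.offDiag.kronecker' (hY.isHermitian.offDiag.kronecker'
          hZ.isHermitian.offDiag)) (a := 2 * (1 / √r) * (2 * (1 / √s) * (2 * (1 / √t))))
        (by positivity) (hX.opLe.offDiag.kronecker (hY.opLe.offDiag.kronecker hZ.opLe.offDiag))
        ?_ ?_ (by positivity) ?_ _
      · rw [trace_kronecker, trace_offDiag, zero_mul]
      · rw [sum_norm_sq_kronecker, sum_norm_sq_kronecker]
        exact mul_le_one₀ (hfrob hX) (by positivity)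
          (mul_le_one₀ (hfrob hY) (by positivity) (hfrob hZ))
      · have h0 : 0 < √(r : ℝ) * (√s * √t) := by linarith
        calc _ = (m : ℝ) / (√r * (√s * √t)) := by
              have := left_ne_zero_of_mul h0.ne'
              have := left_ne_zero_of_mul (right_ne_zero_of_mul h0.ne')
              have := right_ne_zero_of_mul (right_ne_zero_of_mul h0.ne')
              field_simp
              norm_num
          _ ≤ 1 := (div_le_one h0).2 hsq)
  calc _ ≤ _ := measureReal_mono (fun g hg => ?_)
    _ ≤ _ := h
    _ ≤ _ := ?_
  · obtain ⟨hg1, X, Y, Z, hX, hY, hZ, hlt⟩ := hg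
    simp only [Set.mem_ofPred_eq]
    obtain ⟨X', hX', hXX⟩ := hRn₁ X hX
    obtain ⟨Y', hY', hYY⟩ := hRn₂ Y hY
    obtain ⟨Z', hZ', hZZ⟩ := hRn₃ Z hZ
    refine ⟨(X', Y', Z'), by simp [hX', hY', hZ'], ?_⟩
    have he : (0 : ℝ) ≤ 5 * N / (N ^ 10 : ℕ) := by positivity
    have h1 := quadForm₃_sub_le (sum_abs_le_of_abs_le hg1) (hent hY) (hent hZ)
      (hent (hRf₁ _ hX')) (hent (hRf₂ _ hY')) (norm_offDiag_sub_le he hXX)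
      (norm_offDiag_sub_le he hYY) (norm_offDiag_sub_le he hZZ) he
    -- Here `∑ |g p| ≤ N⁴` and the mesh is `5N/N¹⁰`, so leaving the net costs `15/N`.
    have h2 : ((N : ℝ) ^ 4) ^ 2 * (3 * (5 * N / (N ^ 10 : ℕ))) ≤ 1 := by
      calc _ = 15 / (N : ℝ) := by push_cast; field_simp; norm_num
        _ ≤ 1 := by rw [div_le_one (by linarith)]; linarith
    have h3 := norm_sub_norm_le (quadForm₃ g X.offDiag Y.offDiag Z.offDiag)
      (quadForm₃ g X'.offDiag Y'.offDiag Z'.offDiag)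
    simp only
    linarith
  · have hcard : ((R₁ ×ˢ R₂ ×ˢ R₃).card : ℝ) ≤ Real.exp (11 * L * (9 * N * m : ℕ)) := by
      refine le_trans ?_ (net_card_le_exp hN (9 * N * m))
      have h1 : (R₁ ×ˢ R₂ ×ˢ R₃).card ≤ (2 * N ^ 10 + 1) ^ (9 * N * m) := by
        rw [Finset.card_product, Finset.card_product]
        calc R₁.card * (R₂.card * R₃.card) ≤ (2 * N ^ 10 + 1) ^ (3 * N * r) *
              ((2 * N ^ 10 + 1) ^ (3 * N * s) * (2 * N ^ 10 + 1) ^ (3 * N * t)) := by gcongr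
          _ ≤ (2 * N ^ 10 + 1) ^ (3 * N * m) *
              ((2 * N ^ 10 + 1) ^ (3 * N * m) * (2 * N ^ 10 + 1) ^ (3 * N * m)) := by
              gcongr <;> omega
          _ = _ := by rw [← pow_add, ← pow_add]; congr 1; ring
      exact_mod_cast h1
    have h2 : (2 : ℝ) ≤ Real.exp 1 := by linarith [Real.add_one_le_exp (1 : ℝ)]
    -- The tail contributes `3520/32 = 110` times `m N log N`, the net `99`; the surplus `11`
    -- absorbs the prefactor and the quadratic term.
    calc _ ≤ Real.exp (11 * L * (9 * N * m : ℕ)) * (Real.exp 1 *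
          Real.exp (-((m / 32) * (3520 * (N * L))) + 2 * (m / 32 : ℝ) ^ 2)) := by gcongr
      _ ≤ _ := by
        rw [← Real.exp_add, ← Real.exp_add]
        apply Real.exp_le_exp.2
        push_cast
        have hNL : (60 : ℝ) ≤ N * L := by nlinarith
        have h3 : (m : ℝ) ^ 2 ≤ m * (N * L) := by
          rw [pow_two]
          gcongr
          nlinarith
        have h4 : (N : ℝ) * L ≤ m * (N * L) := by nlinarith
        nlinarith

/-- With overwhelming probability the quadratic form is bounded on all triples of flat matrices. -/
theorem stdNormalLaw_flat_bound (hN : 30 ≤ N) :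
    (stdNormalLaw (Triple N)).real
        {g | ¬ ∀ r s t : ℕ, (1 ≤ r ∧ r ≤ N) → (1 ≤ s ∧ s ≤ N) → (1 ≤ t ∧ t ≤ N) →
          ∀ X Y Z : Matrix (Fin N) (Fin N) ℂ, X.IsFlat r → Y.IsFlat s → Z.IsFlat t →
            ‖quadForm₃ g X.offDiag Y.offDiag Z.offDiag‖ ≤ 9600 * (N * Real.log N)}
      ≤ Real.exp (-(N : ℝ)) := by
  have hN' : (30 : ℝ) ≤ N := by exact_mod_cast hN
  have hL := two_le_log_of_le hN
  set L := Real.log N with hLd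
  have hNL : (60 : ℝ) ≤ N * L := by nlinarith
  set T : Finset (ℕ × ℕ × ℕ) := (Finset.Icc 1 N ×ˢ Finset.Icc 1 N ×ˢ Finset.Icc 1 N).filter
    fun τ => τ.1 ≤ τ.2.1 * τ.2.2 ∧ τ.2.1 ≤ τ.2.2 * τ.1 ∧ τ.2.2 ≤ τ.1 * τ.2.1 with hT
  have hTcard : (T.card : ℝ) ≤ Real.exp (3 * L) := by
    have h1 : T.card ≤ N ^ 3 := (Finset.card_filter_le _ _).trans_eq (by simp; ring)
    have h2 : Real.exp (3 * L) = (N : ℝ) ^ 3 := by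
      rw [show (3 : ℝ) * L = ((3 : ℕ) : ℝ) * L by norm_num, Real.exp_nat_mul,
        Real.exp_log (by linarith)]
    rw [h2]
    exact_mod_cast h1
  have h3 := measureReal_exists_le (μ := stdNormalLaw (Triple N)) T
    (P := fun τ g => (∀ p, |g p| ≤ N) ∧ ∃ X Y Z : Matrix (Fin N) (Fin N) ℂ, X.IsFlat τ.1 ∧
      Y.IsFlat τ.2.1 ∧ Z.IsFlat τ.2.2 ∧ 3520 * (N * L) + 1
        < ‖quadForm₃ g X.offDiag Y.offDiag Z.offDiag‖)
    (b := Real.exp (-(10 * (N * L))))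
    (fun τ hτ => by
      simp only [hT, Finset.mem_filter, Finset.mem_product, Finset.mem_Icc] at hτ
      exact stdNormalLaw_flat_net_tail hN hτ.1.1 hτ.1.2.1 hτ.1.2.2 hτ.2.1 hτ.2.2.1 hτ.2.2.2)
  have h1 := stdNormalLaw_exists_large_entry hN
  have h2 := stdNormalLaw_not_injLe hN
  rw [← hLd] at h2
  calc _ ≤ _ := measureReal_mono (fun g hg => ?_)
    _ ≤ _ := (measureReal_union_le _ _).trans
          (add_le_add (measureReal_union_le _ _) le_rfl)
    _ ≤ _ := add_le_add (add_le_add h1 h2) h3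
    _ ≤ _ := ?_
  · by_contra hcon
    simp only [Set.mem_union, not_or, Set.mem_ofPred_eq, not_not] at hcon
    obtain ⟨⟨hc1, hc2⟩, hc3⟩ := hcon
    have hinj : InjLe g (1200 * (N * L)) := by
      by_contra hn
      exact hc2 ⟨hc1, hn⟩
    have hB : 0 ≤ 1200 * (N * L) := by positivity
    refine hg fun r s t hr hs ht X Y Z hX hY hZ => ?_
    -- Balanced ranks are covered by the net event; otherwise one rank dominates the product of the
    -- others and the injective bound applies, with `8 · 1200 = 9600`.
    by_cases hc : r ≤ s * t ∧ s ≤ t * r ∧ t ≤ r * s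
    · have hmem : (r, s, t) ∈ T := by
        simp only [hT, Finset.mem_filter, Finset.mem_product, Finset.mem_Icc]
        exact ⟨⟨hr, hs, ht⟩, hc⟩
      by_contra hlt
      refine hc3 ⟨(r, s, t), hmem, hc1, X, Y, Z, hX, hY, hZ, ?_⟩
      push Not at hlt
      linarith
    · have hcases : s * t ≤ r ∨ t * r ≤ s ∨ r * s ≤ t := by
        by_contra hh
        push Not at hh
        exact hc ⟨hh.1.le, hh.2.1.le, hh.2.2.le⟩
      rcases hcases with h | h | h
      · have := norm_quadForm₃_flat_le_of_mul_le hX hY hZ hB hinj h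
        linarith
      · have := norm_quadForm₃_flat_le_of_mul_le hY hZ hX hB hinj.rotate h
        rw [quadForm₃_rotate] at this
        linarith
      · have := norm_quadForm₃_flat_le_of_mul_le hZ hX hY hB hinj.rotate.rotate h
        rw [quadForm₃_rotate, quadForm₃_rotate] at this
        linarith
  · have e2 : Real.exp (-(8 * (N * L))) ≤ Real.exp (-(2 * N)) := by
      apply Real.exp_le_exp.2; nlinarith
    have e3 : T.card * Real.exp (-(10 * (N * L))) ≤ Real.exp (-(2 * N)) := by
      calc _ ≤ Real.exp (3 * L) * Real.exp (-(10 * (N * L))) := by gcongr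
        _ ≤ _ := by
          rw [← Real.exp_add]
          apply Real.exp_le_exp.2
          nlinarith
    have e4 : 3 * Real.exp (-(2 * N : ℝ)) ≤ Real.exp (-(N : ℝ)) := by
      have h5 : Real.exp (-(N : ℝ)) = Real.exp N * Real.exp (-(2 * N : ℝ)) := by
        rw [← Real.exp_add]; congr 1; ring
      rw [h5]
      have h6 : (3 : ℝ) ≤ Real.exp N := by linarith [Real.add_one_le_exp (N : ℝ)]
      gcongr
    linarith

end Estimates

/-! ### From flat triples to `norm222`. -/

section Trilinear

variable {N : ℕ}

theorem trilin_ofVector_rotate (g : Triple N → ℝ) (X Y Z : Matrix (Fin N) (Fin N) ℂ) :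
    (PairTensor.ofVector (g ∘ (Triple.rotate N).symm)).trilin Y Z X
      = (PairTensor.ofVector g).trilin X Y Z := by
  rw [trilin_ofVector, trilin_ofVector, quadForm₃_rotate]

/-- `Matrix.offDiag` as a linear map. -/
def Matrix.offDiagLin (N : ℕ) : Matrix (Fin N) (Fin N) ℂ →ₗ[ℂ] Matrix (Fin N) (Fin N) ℂ where
  toFun := Matrix.offDiag
  map_add' X Y := by ext i j; simp only [offDiag_apply, Matrix.add_apply]; split_ifs <;> simp
  map_smul' c X := by
    ext i j
    simp only [offDiag_apply, Matrix.smul_apply, RingHom.id_apply]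
    split_ifs <;> simp

/-- The linear map `Z ↦ ⟨T_g, X ⊗ Y ⊗ Z⟩`. -/
noncomputable def trilinLin (g : Triple N → ℝ) (X Y : Matrix (Fin N) (Fin N) ℂ) :
    Matrix (Fin N) (Fin N) ℂ →ₗ[ℂ] ℂ :=
  (quadForm₃Lin g X.offDiag Y.offDiag).comp (Matrix.offDiagLin N)

theorem trilinLin_apply (g : Triple N → ℝ) (X Y Z : Matrix (Fin N) (Fin N) ℂ) :
    trilinLin g X Y Z = (PairTensor.ofVector g).trilin X Y Z := by
  rw [trilin_ofVector]; rfl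

theorem trilinLin_rotate (g : Triple N → ℝ) (X Y Z : Matrix (Fin N) (Fin N) ℂ) :
    trilinLin (g ∘ (Triple.rotate N).symm) Y Z X = trilinLin g X Y Z := by
  rw [trilinLin_apply, trilinLin_apply, trilin_ofVector_rotate]

/-- Cauchy–Schwarz over the `K + 1` dyadic levels gives `∑ c k ≤ √(7 (K + 1))`. It is stated for a
linear functional so that it can be applied to each variable in turn. -/
theorem norm_le_of_flat {T : Matrix (Fin N) (Fin N) ℂ →ₗ[ℂ] ℂ} {W : ℝ} {K : ℕ} (hN : 1 ≤ N)
    (hK : N ≤ 4 ^ K)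
    (h : ∀ (r : ℕ), (1 ≤ r ∧ r ≤ N) → ∀ X : Matrix (Fin N) (Fin N) ℂ, X.IsFlat r → ‖T X‖ ≤ W)
    {X : Matrix (Fin N) (Fin N) ℂ} (hX : X ∈ PairTensor.hermBall N) :
    ‖T X‖ ≤ √(7 * (K + 1)) * W := by
  obtain ⟨c, r, Y, hc, hr, hY, hXY, hc2⟩ := exists_flat_decomposition hN hK hX
  have hW : 0 ≤ W := (norm_nonneg _).trans (h _ (hr 0) _ (hY 0))
  have hsum : ∑ k, c k ≤ √(7 * (K + 1)) := by
    apply Real.le_sqrt_of_sq_le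
    have h1 := sq_sum_le_card_mul_sum_sq (s := Finset.univ) (f := c)
    simp only [Finset.card_univ, Fintype.card_fin] at h1
    push_cast at h1
    nlinarith
  calc ‖T X‖ ≤ ∑ k, c k * W := by
        rw [hXY, map_sum]
        refine norm_sum_le_of_le _ fun k _ => ?_
        rw [map_smul, norm_smul, Complex.norm_real, Real.norm_eq_abs, abs_of_nonneg (hc k)]
        exact mul_le_mul_of_nonneg_left (h _ (hr k) _ (hY k)) (hc k)
    _ = (∑ k, c k) * W := by rw [Finset.sum_mul]
    _ ≤ _ := by gcongr

theorem norm_trilin_le_of_flat {g : Triple N → ℝ} {W : ℝ} {K : ℕ} (hN : 1 ≤ N) (hK : N ≤ 4 ^ K)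
    (h : ∀ r s t : ℕ, (1 ≤ r ∧ r ≤ N) → (1 ≤ s ∧ s ≤ N) → (1 ≤ t ∧ t ≤ N) →
      ∀ X Y Z : Matrix (Fin N) (Fin N) ℂ, X.IsFlat r → Y.IsFlat s → Z.IsFlat t →
        ‖quadForm₃ g X.offDiag Y.offDiag Z.offDiag‖ ≤ W)
    {X Y Z : Matrix (Fin N) (Fin N) ℂ} (hX : X ∈ PairTensor.hermBall N)
    (hY : Y ∈ PairTensor.hermBall N) (hZ : Z ∈ PairTensor.hermBall N) :
    ‖(PairTensor.ofVector g).trilin X Y Z‖ ≤ √(7 * (K + 1)) ^ 3 * W := by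
  set A := √(7 * ((K : ℝ) + 1))
  have h1 : ∀ r s : ℕ, (1 ≤ r ∧ r ≤ N) → (1 ≤ s ∧ s ≤ N) →
      ∀ X Y : Matrix (Fin N) (Fin N) ℂ, X.IsFlat r → Y.IsFlat s →
        ‖trilinLin g X Y Z‖ ≤ A * W := fun r s hr hs X Y hX hY =>
    norm_le_of_flat hN hK (fun t ht Z hZ => h r s t hr hs ht X Y Z hX hY hZ) hZ
  have h2 : ∀ r : ℕ, (1 ≤ r ∧ r ≤ N) → ∀ X : Matrix (Fin N) (Fin N) ℂ, X.IsFlat r →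
      ‖trilinLin g X Y Z‖ ≤ A * (A * W) := by
    intro r hr X hX
    rw [← trilinLin_rotate, ← trilinLin_rotate]
    refine norm_le_of_flat hN hK (fun s hs Y hY => ?_) hY
    rw [trilinLin_rotate, trilinLin_rotate]
    exact h1 r s hr hs X Y hX hY
  have h3 : ‖trilinLin g X Y Z‖ ≤ A * (A * (A * W)) := by
    rw [← trilinLin_rotate]
    refine norm_le_of_flat hN hK (fun r hr X hX => ?_) hX
    rw [trilinLin_rotate]
    exact h2 r hr X hX
  rw [trilinLin_apply] at h3
  exact h3.trans_eq (by ring)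

theorem log_pow_five_half {L : ℝ} (hL : 0 < L) : L ^ (5 / 2 : ℝ) = L ^ 2 * √L := by
  rw [Real.sqrt_eq_rpow, ← Real.rpow_natCast, ← Real.rpow_add hL]
  norm_num

theorem clog_succ_le (hN : 30 ≤ N) : ((Nat.clog 4 N : ℕ) : ℝ) + 1 ≤ 2 * Real.log N := by
  have hN' : (30 : ℝ) ≤ N := by exact_mod_cast hN
  have hL := two_le_log_of_le hN
  have h1 : 4 ^ (Nat.clog 4 N).pred < N := Nat.pow_pred_clog_lt_self (by norm_num) (by omega)
  have h2 : (((Nat.clog 4 N).pred : ℕ) : ℝ) * Real.log 4 ≤ Real.log N := by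
    rw [← Real.log_pow]
    apply Real.log_le_log (by positivity)
    exact_mod_cast h1.le
  have h4 : (1 : ℝ) ≤ Real.log 4 := by
    rw [show (4 : ℝ) = 2 ^ (2 : ℕ) by norm_num, Real.log_pow]
    have := Real.log_two_gt_d9
    push_cast
    linarith
  have h5 : (((Nat.clog 4 N : ℕ)) : ℝ) ≤ ((Nat.clog 4 N).pred : ℕ) + 1 := by
    have : Nat.clog 4 N ≤ (Nat.clog 4 N).pred + 1 := by
      rw [Nat.pred_eq_sub_one]; omega
    exact_mod_cast this
  have h6 : (0 : ℝ) ≤ ((Nat.clog 4 N).pred : ℕ) := by positivity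
  nlinarith

theorem norm222_le_of_flat {g : Triple N → ℝ} (hN : 30 ≤ N)
    (h : ∀ r s t : ℕ, (1 ≤ r ∧ r ≤ N) → (1 ≤ s ∧ s ≤ N) → (1 ≤ t ∧ t ≤ N) →
      ∀ X Y Z : Matrix (Fin N) (Fin N) ℂ, X.IsFlat r → Y.IsFlat s → Z.IsFlat t →
        ‖quadForm₃ g X.offDiag Y.offDiag Z.offDiag‖ ≤ 9600 * (N * Real.log N)) :
    (PairTensor.ofVector g).norm222 ≤ 614400 * N * Real.log N ^ (5 / 2 : ℝ) := by
  have hL := two_le_log_of_le hN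
  have hK := clog_succ_le hN
  rw [log_pow_five_half (by linarith)]
  set L := Real.log N with hLd
  apply Real.sSup_le _ (by positivity)
  rintro _ ⟨X, hX, Y, hY, Z, hZ, rfl⟩
  have h1 := norm_trilin_le_of_flat (by omega) (Nat.le_pow_clog (by norm_num) N) h hX hY hZ
  refine h1.trans ?_
  -- Since `K + 1 ≤ 2 log N`, the radicand is at most `14 log N`; cubing `4√L` gives `64 · 9600 =
  -- 614400`.
  have h2 : √(7 * (((Nat.clog 4 N : ℕ) : ℝ) + 1)) ≤ 4 * √L := by
    rw [Real.sqrt_le_left (by positivity), mul_pow, Real.sq_sqrt (by linarith)]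
    linarith
  calc _ ≤ (4 * √L) ^ 3 * (9600 * (N * L)) := by gcongr
    _ = 614400 * N * (√L ^ 2 * √L * L) := by ring
    _ = 614400 * N * (L ^ 2 * √L) := by rw [Real.sq_sqrt (by linarith)]; ring

theorem gaussianLaw_norm222_tail (hN : 30 ≤ N) :
    (PairTensor.gaussianLaw N).real {g | ¬ ((PairTensor.ofVector g).norm222
      ≤ 614400 * N * Real.log N ^ (5 / 2 : ℝ))} ≤ Real.exp (-(N : ℝ)) := by
  refine (measureReal_mono (fun g hg => ?_)
    (measure_ne_top (stdNormalLaw (Triple N)) _)).trans (stdNormalLaw_flat_bound hN)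
  exact fun h => hg (norm222_le_of_flat hN h)

end Trilinear

/-! ### Concentration of `norm33`. -/

section Bilinear

variable {N : ℕ}

/-- The matrix is block diagonal along the fibres of `π`, and each block is rank one with norm the
squared length of `g` on that fibre. -/
theorem sum_block_mul_le {α β : Type*} [Fintype α] [Fintype β] [DecidableEq β] (π : α → β)
    {g x y : α → ℝ} {t : ℝ} (hg : ∀ i, ∑ p, (if π p = i then g p ^ 2 else 0) ≤ t)
    (hx : ∑ p, x p ^ 2 = 1) (hy : ∑ p, y p ^ 2 = 1) :
    ∑ p, ∑ q, (if π p = π q then (g p * x p) * (g q * y q) else 0) ≤ t := by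
  have hfib : ∀ (w : α → ℝ), ∑ p, w p ^ 2 = 1 →
      ∑ i, (∑ p, if π p = i then g p * w p else 0) ^ 2 ≤ t := by
    intro w hw
    calc ∑ i, (∑ p, if π p = i then g p * w p else 0) ^ 2
        ≤ ∑ i, t * ∑ p, (if π p = i then w p ^ 2 else 0) := by
          refine Finset.sum_le_sum fun i _ => ?_
          have h1 := Finset.sum_mul_sq_le_sq_mul_sq Finset.univ
            (fun p => if π p = i then g p else 0) (fun p => if π p = i then w p else 0)
          simp only [ite_mul, zero_mul, mul_ite, mul_zero, ite_pow, ne_eq, OfNat.ofNat_ne_zero,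
            not_false_eq_true, zero_pow] at h1
          refine le_trans (le_of_eq ?_) (h1.trans (mul_le_mul_of_nonneg_right (hg i) ?_))
          · congr 1
            exact Finset.sum_congr rfl fun p _ => by split_ifs <;> rfl
          · exact Finset.sum_nonneg fun p _ => by split_ifs <;> positivity
      _ = t := by
          rw [← Finset.mul_sum, Finset.sum_comm]
          simp [hw]
  have hx' := hfib x hx
  have hy' := hfib y hy
  have key : ∑ p, ∑ q, (if π p = π q then (g p * x p) * (g q * y q) else 0)
      = ∑ i, (∑ p, if π p = i then g p * x p else 0) * ∑ q, if π q = i then g q * y q else 0 := by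
    simp only [Finset.sum_mul_sum]
    rw [Finset.sum_comm]
    conv_rhs => rw [Finset.sum_comm]
    rw [Finset.sum_comm]
    refine Finset.sum_congr rfl fun p _ => ?_
    rw [Finset.sum_comm]
    refine Finset.sum_congr rfl fun q _ => ?_
    rw [Finset.sum_eq_single (π p)]
    · by_cases h : π p = π q
      · simp [h]
      · simp [h, Ne.symm h]
    · intro i _ hi
      simp [hi.symm]
    · simp
  rw [key]
  calc _ ≤ ∑ i, ((∑ p, if π p = i then g p * x p else 0) ^ 2
        + (∑ q, if π q = i then g q * y q else 0) ^ 2) / 2 := by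
        refine Finset.sum_le_sum fun i _ => ?_
        nlinarith [sq_nonneg ((∑ p, if π p = i then g p * x p else 0)
          - ∑ q, if π q = i then g q * y q else 0)]
    _ ≤ t := by
        rw [← Finset.sum_div, Finset.sum_add_distrib]
        linarith

/-- All two-dimensional slices of `g` have squared Euclidean norm at most `t`. -/
def SlicesLe (g : Triple N → ℝ) (t : ℝ) : Prop :=
  (∀ i, ∑ p : Triple N, (if p.1 = i then g p ^ 2 else 0) ≤ t) ∧
  (∀ i, ∑ p : Triple N, (if p.2.1 = i then g p ^ 2 else 0) ≤ t) ∧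
  (∀ i, ∑ p : Triple N, (if p.2.2 = i then g p ^ 2 else 0) ≤ t)

/-- The difference from `g gᵀ` lives on pairs sharing a coordinate. In absolute value it is
dominated by three block-diagonal matrices, one per coordinate. -/
theorem norm_bilin_sub_le {g : Triple N → ℝ} {t : ℝ} (hg : SlicesLe g t)
    {x y : EuclideanSpace ℂ (Triple N)} (hx : ‖x‖ = 1) (hy : ‖y‖ = 1) :
    ‖(PairTensor.ofVector g).bilin x y
      - (∑ p, (g p : ℂ) * x p) * ∑ q, (g q : ℂ) * y q‖ ≤ 3 * t := by
  have hx2 : ∑ p, ‖x p‖ ^ 2 = 1 := by rw [← EuclideanSpace.norm_sq_eq, hx, one_pow]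
  have hy2 : ∑ p, ‖y p‖ ^ 2 = 1 := by rw [← EuclideanSpace.norm_sq_eq, hy, one_pow]
  have hsq : ∀ p, |g p| ^ 2 = g p ^ 2 := fun p => sq_abs _
  have h1 := sum_block_mul_le (fun p : Triple N => p.1) (g := fun p => |g p|)
    (by simpa only [hsq] using hg.1) hx2 hy2
  have h2 := sum_block_mul_le (fun p : Triple N => p.2.1) (g := fun p => |g p|)
    (by simpa only [hsq] using hg.2.1) hx2 hy2
  have h3 := sum_block_mul_le (fun p : Triple N => p.2.2) (g := fun p => |g p|)
    (by simpa only [hsq] using hg.2.2) hx2 hy2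
  rw [PairTensor.bilin, Finset.sum_mul_sum, ← Finset.sum_sub_distrib]
  simp only [← Finset.sum_sub_distrib]
  calc _ ≤ ∑ p, ∑ q, ((if p.1 = q.1 then (|g p| * ‖x p‖) * (|g q| * ‖y q‖) else 0)
        + (if p.2.1 = q.2.1 then (|g p| * ‖x p‖) * (|g q| * ‖y q‖) else 0)
        + (if p.2.2 = q.2.2 then (|g p| * ‖x p‖) * (|g q| * ‖y q‖) else 0)) := by
        refine norm_sum_le_of_le _ fun p _ => norm_sum_le_of_le _ fun q _ => ?_
        have h0 : 0 ≤ (|g p| * ‖x p‖) * (|g q| * ‖y q‖) := by positivity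
        by_cases hc : p.1 ≠ q.1 ∧ p.2.1 ≠ q.2.1 ∧ p.2.2 ≠ q.2.2
        · have he : PairTensor.ofVector g (p.1, q.1) (p.2.1, q.2.1) (p.2.2, q.2.2) * x p * y q
              - (g p : ℂ) * x p * ((g q : ℂ) * y q) = 0 := by
            simp only [PairTensor.ofVector, hc, ne_eq, not_false_eq_true, and_self, if_true]
            push_cast
            ring
          rw [he, norm_zero]
          simp [hc]
        · have he : ‖PairTensor.ofVector g (p.1, q.1) (p.2.1, q.2.1) (p.2.2, q.2.2) * x p * y q
              - (g p : ℂ) * x p * ((g q : ℂ) * y q)‖ = (|g p| * ‖x p‖) * (|g q| * ‖y q‖) := by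
            simp only [PairTensor.ofVector, hc, if_false, zero_mul, zero_sub, norm_neg, norm_mul,
              Complex.norm_real, Real.norm_eq_abs]
          rw [he]
          have hc' : p.1 = q.1 ∨ p.2.1 = q.2.1 ∨ p.2.2 = q.2.2 := by tauto
          rcases hc' with h | h | h
          · rw [if_pos h]; split_ifs <;> linarith
          · rw [if_pos h]; split_ifs <;> linarith
          · rw [if_pos h]; split_ifs <;> linarith
    _ ≤ _ := by
        simp only [Finset.sum_add_distrib]
        linarith

theorem norm_bilin_le {g : Triple N → ℝ} {t : ℝ} (hg : SlicesLe g t)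
    {x y : EuclideanSpace ℂ (Triple N)} (hx : ‖x‖ = 1) (hy : ‖y‖ = 1) :
    ‖(PairTensor.ofVector g).bilin x y‖ ≤ ∑ p, g p ^ 2 + 3 * t := by
  have hlin : ∀ w : EuclideanSpace ℂ (Triple N), ‖w‖ = 1 →
      ‖∑ p, (g p : ℂ) * w p‖ ^ 2 ≤ ∑ p, g p ^ 2 := by
    intro w hw
    have h := norm_sum_mul_sq_le (fun p => (g p : ℂ)) w
    rw [← EuclideanSpace.norm_sq_eq w, hw] at h
    simpa using h
  have h1 := norm_bilin_sub_le hg hx hy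
  have h2 := norm_sub_norm_le ((PairTensor.ofVector g).bilin x y)
    ((∑ p, (g p : ℂ) * x p) * ∑ q, (g q : ℂ) * y q)
  rw [norm_mul] at h2
  nlinarith [hlin x hx, hlin y hy,
    sq_nonneg (‖∑ p, (g p : ℂ) * x p‖ - ‖∑ p, (g p : ℂ) * y p‖)]

theorem norm33_le {g : Triple N → ℝ} {t : ℝ} (ht : 0 ≤ t) (hg : SlicesLe g t) :
    (PairTensor.ofVector g).norm33 ≤ ∑ p, g p ^ 2 + 3 * t := by
  apply Real.sSup_le _ (by positivity)
  rintro _ ⟨x, y, hx, hy, rfl⟩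
  exact norm_bilin_le hg hx hy

/-- Used with an arbitrary `g` to know that the supremum defining `norm33` is over a bounded set. -/
theorem exists_slicesLe (g : Triple N → ℝ) : ∃ t, 0 ≤ t ∧ SlicesLe g t := by
  have h : ∀ (π : Triple N → Fin N) (i : Fin N),
      ∑ p, (if π p = i then g p ^ 2 else 0) ≤ ∑ p, g p ^ 2 := fun π i =>
    Finset.sum_le_sum fun p _ => by split_ifs <;> nlinarith [sq_nonneg (g p)]
  exact ⟨∑ p, g p ^ 2, by positivity, h (fun p => p.1), h (fun p => p.2.1), h (fun p => p.2.2)⟩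

theorem norm_bilin_le_norm33 (g : Triple N → ℝ) {x y : EuclideanSpace ℂ (Triple N)}
    (hx : ‖x‖ = 1) (hy : ‖y‖ = 1) :
    ‖(PairTensor.ofVector g).bilin x y‖ ≤ (PairTensor.ofVector g).norm33 := by
  obtain ⟨t, -, ht⟩ := exists_slicesLe g
  refine le_csSup ⟨∑ p, g p ^ 2 + 3 * t, ?_⟩ ⟨x, y, hx, hy, rfl⟩
  rintro _ ⟨x, y, hx, hy, rfl⟩
  exact norm_bilin_le ht hx hy

/-- The test vectors are both `g/‖g‖`, on which `g gᵀ` attains its norm. -/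
theorem le_norm33 {g : Triple N → ℝ} {t : ℝ} (hg : SlicesLe g t) (hpos : 0 < ∑ p, g p ^ 2) :
    ∑ p, g p ^ 2 - 3 * t ≤ (PairTensor.ofVector g).norm33 := by
  set G := ∑ p, g p ^ 2 with hG
  have hs : 0 < √G := Real.sqrt_pos.2 hpos
  set x : EuclideanSpace ℂ (Triple N) := toLp 2 fun p => ((g p / √G : ℝ) : ℂ) with hx
  have hx1 : ‖x‖ = 1 := by
    rw [EuclideanSpace.norm_eq, Real.sqrt_eq_one]
    simp only [hx, Complex.norm_real, Real.norm_eq_abs, sq_abs, div_pow, Real.sq_sqrt hpos.le]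
    rw [← Finset.sum_div, div_self hpos.ne']
  have hlin : ∑ p, (g p : ℂ) * x p = (√G : ℂ) := by
    have h1 : ∑ p, g p * (g p / √G) = √G := by
      simp only [← mul_div_assoc, ← pow_two]
      rw [← Finset.sum_div, ← hG, Real.div_sqrt]
    rw [← h1]
    push_cast
    exact Finset.sum_congr rfl fun p _ => by simp [hx]
  refine le_trans ?_ (norm_bilin_le_norm33 g hx1 hx1)
  have h2 := norm_bilin_sub_le hg hx1 hx1
  rw [hlin, ← Complex.ofReal_mul, Real.mul_self_sqrt hpos.le] at h2
  have h3 := norm_sub_norm_le ((G : ℝ) : ℂ) ((PairTensor.ofVector g).bilin x x)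
  rw [norm_sub_rev, Complex.norm_real, Real.norm_eq_abs, abs_of_pos hpos] at h3
  linarith

theorem stdNormalLaw_sum_sq_upper {n η : ℝ} {ι : Type*} [Fintype ι] [DecidableEq ι]
    (hn : n = Fintype.card ι) (hη : 0 ≤ η) (hη1 : η ≤ 1) :
    (stdNormalLaw ι).real {g | (1 + η) * n ≤ ∑ p, g p ^ 2} ≤ Real.exp (-(η ^ 2 * n / 8)) := by
  have h := stdNormalLaw_diag_tail (ι := ι) (d := fun _ => 1) (fun _ => le_rfl) (s := η / 4)
    (by positivity) (by linarith) ((1 + η) * n)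
  simp only [one_mul, one_pow, Finset.sum_const, Finset.card_univ, nsmul_eq_mul, mul_one,
    ← hn] at h
  exact h.trans_eq (by congr 1; ring)

theorem stdNormalLaw_sum_sq_lower {n η : ℝ} {ι : Type*} [Fintype ι] [DecidableEq ι]
    (hn : n = Fintype.card ι) (hη : 0 ≤ η) (hη1 : η ≤ 1) :
    (stdNormalLaw ι).real {g | ∑ p, g p ^ 2 ≤ (1 - η) * n} ≤ Real.exp (-(η ^ 2 * n / 8)) := by
  have h := stdNormalLaw_diag_tail (ι := ι) (d := fun _ => -1) (fun _ => by norm_num) (s := η / 4)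
    (by positivity) (by linarith) (-((1 - η) * n))
  simp only [neg_mul, one_mul, neg_sq, one_pow, Finset.sum_const, Finset.card_univ, nsmul_eq_mul,
    mul_one, Finset.sum_neg_distrib, neg_le_neg_iff, mul_neg, smul_neg, ← hn] at h
  exact h.trans_eq (by congr 1; ring)

theorem stdNormalLaw_slice_tail (π : Triple N → Fin N)
    (hπ : ∀ i, ∑ p, (if π p = i then (1 : ℝ) else 0) = (N : ℝ) ^ 2) :
    (stdNormalLaw (Triple N)).real
        {g | ∃ i ∈ (Finset.univ : Finset (Fin N)),
          7 * (N : ℝ) ^ 2 ≤ ∑ p, (if π p = i then g p ^ 2 else 0)}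
      ≤ N * Real.exp (-(11 / 8 * (N : ℝ) ^ 2)) := by
  have h := measureReal_exists_le (μ := stdNormalLaw (Triple N)) (Finset.univ : Finset (Fin N))
    (P := fun i g => 7 * (N : ℝ) ^ 2 ≤ ∑ p, (if π p = i then g p ^ 2 else 0))
    (b := Real.exp (-(11 / 8 * (N : ℝ) ^ 2))) (fun i _ => by
      have h1 := stdNormalLaw_diag_tail (ι := Triple N) (d := fun p => if π p = i then 1 else 0)
        -- The exponent is `-7/4 + 1/4 + 1/8 = -11/8` times `N²`.
        (fun p => by split_ifs <;> norm_num) (s := 1 / 4) (by norm_num) le_rfl (7 * (N : ℝ) ^ 2)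
      simp only [ite_mul, one_mul, zero_mul, ite_pow, one_pow, ne_eq, OfNat.ofNat_ne_zero,
        not_false_eq_true, zero_pow, hπ] at h1
      refine h1.trans_eq ?_
      congr 1; ring)
  simpa using h

theorem gaussianLaw_norm33_tail {δ : ℝ} (hδ : 0 < δ) (hδ1 : δ < 1) (hN : 64 / δ ^ 2 ≤ N) :
    (PairTensor.gaussianLaw N).real
        {g | ¬ ((1 - δ) * (N : ℝ) ^ 3 ≤ (PairTensor.ofVector g).norm33 ∧
            (PairTensor.ofVector g).norm33 ≤ (1 + δ) * (N : ℝ) ^ 3)}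
      ≤ Real.exp (-(1 * δ ^ 2 * (N : ℝ) ^ 2)) := by
  have hδN : 64 ≤ N * δ ^ 2 := by rwa [div_le_iff₀ (by positivity)] at hN
  have hδ2 : δ ^ 2 ≤ δ := by nlinarith
  have hN0 : (0 : ℝ) ≤ N := by positivity
  have hδN1 : 64 ≤ N * δ := hδN.trans (by gcongr)
  have hN64 : (64 : ℝ) ≤ N := by nlinarith
  have hcard : (N : ℝ) ^ 3 = Fintype.card (Triple N) := by simp; ring
  have hu := stdNormalLaw_sum_sq_upper (η := δ / 2) hcard (by positivity) (by linarith)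
  have hl := stdNormalLaw_sum_sq_lower (η := δ / 2) hcard (by positivity) (by linarith)
  have s1 := stdNormalLaw_slice_tail (N := N) (fun p => p.1)
    (fun i => by
      simp only [Fintype.sum_prod_type]
      change ∑ a : Fin N, ∑ b : Fin N, ∑ c : Fin N, (if a = i then (1 : ℝ) else 0) = _
      simp [pow_two])
  have s2 := stdNormalLaw_slice_tail (N := N) (fun p => p.2.1)
    (fun i => by
      simp only [Fintype.sum_prod_type]
      change ∑ a : Fin N, ∑ b : Fin N, ∑ c : Fin N, (if b = i then (1 : ℝ) else 0) = _
      simp [pow_two])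
  have s3 := stdNormalLaw_slice_tail (N := N) (fun p => p.2.2)
    (fun i => by
      simp only [Fintype.sum_prod_type]
      change ∑ a : Fin N, ∑ b : Fin N, ∑ c : Fin N, (if c = i then (1 : ℝ) else 0) = _
      simp [pow_two])
  -- Half of `δ` is spent on the fluctuation of `‖g‖²`, the other half on the three slice errors
  -- `7N²`.
  have hmain : (21 : ℝ) * N ^ 2 ≤ δ / 2 * N ^ 3 := by
    nlinarith [mul_le_mul_of_nonneg_right hδN1 (sq_nonneg (N : ℝ))]
  calc (stdNormalLaw (Triple N)).real _ ≤ _ := measureReal_mono (fun g hg => ?_)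
    _ ≤ _ := (measureReal_union_le _ _).trans (add_le_add ((measureReal_union_le _ _).trans
          (add_le_add hu hl)) ((measureReal_union_le _ _).trans (add_le_add
            ((measureReal_union_le _ _).trans (add_le_add s1 s2)) s3)))
    _ ≤ _ := ?_
  · by_contra hcon
    simp only [Set.mem_union, not_or, Set.mem_ofPred_eq, not_le, not_exists, not_and,
      Finset.mem_univ, forall_true_left] at hcon
    obtain ⟨⟨hc1, hc2⟩, ⟨hc3, hc4⟩, hc5⟩ := hcon
    have hsl : SlicesLe g (7 * (N : ℝ) ^ 2) :=
      ⟨fun i => (hc3 i).le, fun i => (hc4 i).le, fun i => (hc5 i).le⟩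
    have hG : 0 < ∑ p, g p ^ 2 := by
      refine lt_of_le_of_lt ?_ hc2
      have : 0 ≤ 1 - δ / 2 := by linarith
      positivity
    have h1 := norm33_le (by positivity) hsl
    have h2 := le_norm33 hsl hG
    refine hg ⟨?_, ?_⟩ <;> linarith
  · have hd : δ ^ 2 * (N : ℝ) ^ 2 ≤ N ^ 2 := by nlinarith [sq_nonneg (N : ℝ)]
    have e0 : Real.exp (-((N : ℝ) ^ 2)) ≤ Real.exp (-(1 * δ ^ 2 * (N : ℝ) ^ 2)) := by
      apply Real.exp_le_exp.2; linarith
    refine le_trans ?_ e0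
    have e1 : Real.exp (-((δ / 2) ^ 2 * (N : ℝ) ^ 3 / 8)) ≤ Real.exp (-(11 / 8 * (N : ℝ) ^ 2)) := by
      apply Real.exp_le_exp.2
      nlinarith [mul_le_mul_of_nonneg_right hδN (sq_nonneg (N : ℝ))]
    have e2 : Real.exp (-((N : ℝ) ^ 2))
        = Real.exp (3 / 8 * (N : ℝ) ^ 2) * Real.exp (-(11 / 8 * (N : ℝ) ^ 2)) := by
      rw [← Real.exp_add]; congr 1; ring
    have e3 : 2 + 3 * (N : ℝ) ≤ Real.exp (3 / 8 * (N : ℝ) ^ 2) := by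
      have := Real.add_one_le_exp (3 / 8 * (N : ℝ) ^ 2)
      nlinarith
    rw [e2]
    have e4 := mul_le_mul_of_nonneg_right e3 (Real.exp_pos (-(11 / 8 * (N : ℝ) ^ 2))).le
    linarith

end Bilinear

/-! ### Nonvanishing of the norms and existence of a tensor with large ratio. -/

section Positivity

variable {N : ℕ}

open scoped Matrix.Norms.Frobenius in
-- Hermitian matrices span all complex matrices, and scaling brings any of them into the ball.
theorem eq_zero_of_forall_hermBall {T : Matrix (Fin N) (Fin N) ℂ →ₗ[ℂ] ℂ}
    (h : ∀ X ∈ PairTensor.hermBall N, T X = 0) (X : Matrix (Fin N) (Fin N) ℂ) : T X = 0 := by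
  have hH : ∀ H : Matrix (Fin N) (Fin N) ℂ, H.IsHermitian → T H = 0 := by
    intro H hH
    have hpos : 0 < ‖H‖ + 1 := by positivity
    have h1 := h ((((‖H‖ + 1)⁻¹ : ℝ) : ℂ) • H) ⟨?_, ?_⟩
    · rw [map_smul, smul_eq_zero] at h1
      refine h1.resolve_left ?_
      exact_mod_cast (inv_pos.2 hpos).ne'
    · rw [Matrix.IsHermitian, conjTranspose_smul, hH.eq]
      congr 1
      exact Complex.conj_ofReal _
    · rw [norm_smul, Complex.norm_real, norm_inv, Real.norm_of_nonneg hpos.le,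
        inv_mul_le_one₀ hpos]
      linarith
  have hX : X = (1 / 2 : ℂ) • (X + Xᴴ) + (-Complex.I / 2) • (Complex.I • (X - Xᴴ)) := by
    rw [smul_smul, show -Complex.I / 2 * Complex.I = 1 / 2 by
      rw [div_mul_eq_mul_div, neg_mul, Complex.I_mul_I]; norm_num, ← smul_add]
    ext i j
    simp
    ring
  rw [hX, map_add, map_smul, map_smul, hH _ (isHermitian_add_transpose_self X), hH]
  · simp
  · rw [Matrix.IsHermitian, conjTranspose_smul, conjTranspose_sub, conjTranspose_conjTranspose,
      Complex.star_def, Complex.conj_I, neg_smul, ← smul_neg, neg_sub]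

/-- Two index triples that differ in all three coordinates. -/
def Triple.AllNe (p q : Triple N) : Prop := p.1 ≠ q.1 ∧ p.2.1 ≠ q.2.1 ∧ p.2.2 ≠ q.2.2

theorem ofVector_of_allNe (g : Triple N → ℝ) {p q : Triple N} (h : p.AllNe q) :
    PairTensor.ofVector g (p.1, q.1) (p.2.1, q.2.1) (p.2.2, q.2.2) = ((g p * g q : ℝ) : ℂ) :=
  if_pos h

theorem trilin_single (T : PairTensor N) (p q : Triple N) :
    T.trilin (single p.1 q.1 1) (single p.2.1 q.2.1 1) (single p.2.2 q.2.2 1)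
      = T (p.1, q.1) (p.2.1, q.2.1) (p.2.2, q.2.2) := by
  rw [PairTensor.trilin, Finset.sum_eq_single p, Finset.sum_eq_single q]
  · simp
  · rintro ⟨a, b, c⟩ - hne
    by_contra hcon
    simp only [single_apply, mul_ite, mul_one, mul_zero, ite_eq_right_iff, not_forall] at hcon
    obtain ⟨h1, h2, h3, -⟩ := hcon
    exact hne (Prod.ext h3.2.symm (Prod.ext h2.2.symm h1.2.symm))
  · simp
  · rintro ⟨a, b, c⟩ - hne
    refine Finset.sum_eq_zero fun q' _ => ?_
    by_contra hcon
    simp only [single_apply, mul_ite, mul_one, mul_zero, ite_eq_right_iff, not_forall] at hcon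
    obtain ⟨h1, h2, h3, -⟩ := hcon
    exact hne (Prod.ext h3.1.symm (Prod.ext h2.1.symm h1.1.symm))
  · simp

theorem norm_trilin_le_norm222 (g : Triple N → ℝ) {X Y Z : Matrix (Fin N) (Fin N) ℂ}
    (hX : X ∈ PairTensor.hermBall N) (hY : Y ∈ PairTensor.hermBall N)
    (hZ : Z ∈ PairTensor.hermBall N) :
    ‖(PairTensor.ofVector g).trilin X Y Z‖ ≤ (PairTensor.ofVector g).norm222 := by
  refine le_csSup ⟨(∑ p, |g p|) ^ 2 * (3 * 1), ?_⟩ ⟨X, hX, Y, hY, Z, hZ, rfl⟩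
  rintro _ ⟨X, hX, Y, hY, Z, hZ, rfl⟩
  have hent : ∀ {X : Matrix (Fin N) (Fin N) ℂ}, X ∈ PairTensor.hermBall N →
      ∀ i j, ‖X.offDiag i j‖ ≤ 1 := fun hX i j => (norm_offDiag_apply_le _ i j).trans
    (norm_apply_le_one_of_frob (PairTensor.sum_norm_sq_le_of_mem_hermBall hX) i j)
  have h := quadForm₃_sub_le (g := g) le_rfl (hent hY) (hent hZ) (X' := 0) (Y' := 0) (Z' := 0)
    (by simp) (by simp) (by simpa using hent hX) (by simpa using hent hY) (by simpa using hent hZ)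
    zero_le_one
  have h0 : quadForm₃ g 0 0 0 = 0 := by simp [quadForm₃]
  rwa [h0, sub_zero, ← trilin_ofVector] at h

/-- Positivity is needed because a ratio with zero denominator is `0` in Lean. If the norm vanished,
the trilinear form would vanish on all complex matrices, one variable at a time, and matrix units
would read off a zero entry. -/
theorem norm222_pos {g : Triple N → ℝ} {p q : Triple N} (h : p.AllNe q) (hg : g p * g q ≠ 0) :
    0 < (PairTensor.ofVector g).norm222 := by
  by_contra hcon
  have h0 : ∀ X ∈ PairTensor.hermBall N, ∀ Y ∈ PairTensor.hermBall N,
      ∀ Z ∈ PairTensor.hermBall N, trilinLin g X Y Z = 0 := by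
    intro X hX Y hY Z hZ
    rw [trilinLin_apply, ← norm_le_zero_iff]
    exact (norm_trilin_le_norm222 g hX hY hZ).trans (not_lt.1 hcon)
  have h1 : ∀ X ∈ PairTensor.hermBall N, ∀ Y ∈ PairTensor.hermBall N, ∀ Z,
      trilinLin g X Y Z = 0 := fun X hX Y hY Z => eq_zero_of_forall_hermBall (h0 X hX Y hY) Z
  have h2 : ∀ X ∈ PairTensor.hermBall N, ∀ Y Z, trilinLin g X Y Z = 0 := by
    intro X hX Y Z
    rw [← trilinLin_rotate, ← trilinLin_rotate]
    refine eq_zero_of_forall_hermBall (fun Y hY => ?_) Y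
    rw [trilinLin_rotate, trilinLin_rotate]
    exact h1 X hX Y hY Z
  have h3 : ∀ X Y Z, trilinLin g X Y Z = 0 := by
    intro X Y Z
    rw [← trilinLin_rotate]
    refine eq_zero_of_forall_hermBall (fun X hX => ?_) X
    rw [trilinLin_rotate]
    exact h2 X hX Y Z
  have h4 := h3 (single p.1 q.1 1) (single p.2.1 q.2.1 1) (single p.2.2 q.2.2 1)
  rw [trilinLin_apply, trilin_single, ofVector_of_allNe g h] at h4
  exact hg (by exact_mod_cast h4)

theorem norm33_pos {g : Triple N → ℝ} {p q : Triple N} (h : p.AllNe q) (hg : g p * g q ≠ 0) :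
    0 < (PairTensor.ofVector g).norm33 := by
  refine lt_of_lt_of_le ?_ (norm_bilin_le_norm33 g (x := EuclideanSpace.single p 1)
    (y := EuclideanSpace.single q 1) (by simp) (by simp))
  have h1 : (PairTensor.ofVector g).bilin (EuclideanSpace.single p 1) (EuclideanSpace.single q 1)
      = ((g p * g q : ℝ) : ℂ) := by
    rw [PairTensor.bilin, Finset.sum_eq_single p, Finset.sum_eq_single q,
      ofVector_of_allNe g h]
    · simp
    · intro q' _ hq'
      simp [hq']
    · simp
    · intro p' _ hp'
      simp [hp']
    · simp
  rw [h1, norm_pos_iff]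
  exact_mod_cast hg

theorem exists_allNe_of_norm33_pos {g : Triple N → ℝ} (h : 0 < (PairTensor.ofVector g).norm33) :
    ∃ p q : Triple N, p.AllNe q ∧ g p * g q ≠ 0 := by
  by_contra hcon
  push Not at hcon
  refine h.not_ge (Real.sSup_le ?_ le_rfl)
  rintro _ ⟨x, y, -, -, rfl⟩
  rw [norm_le_zero_iff]
  refine Finset.sum_eq_zero fun p _ => Finset.sum_eq_zero fun q _ => ?_
  by_cases hpq : p.AllNe q
  · rw [ofVector_of_allNe g hpq, hcon p q hpq]; simp
  · have : PairTensor.ofVector g (p.1, q.1) (p.2.1, q.2.1) (p.2.2, q.2.2) = 0 := if_neg hpq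
    rw [this]; simp

theorem exists_ratio_pos (hN : 2 ≤ N) :
    ∃ g : Triple N → ℝ, 0 < (PairTensor.ofVector g).norm33 / (PairTensor.ofVector g).norm222 := by
  have hne : (⟨0, by omega⟩ : Fin N) ≠ ⟨1, by omega⟩ := by simp
  have h : Triple.AllNe (N := N) (⟨0, by omega⟩, ⟨0, by omega⟩, ⟨0, by omega⟩)
      (⟨1, by omega⟩, ⟨1, by omega⟩, ⟨1, by omega⟩) := ⟨hne, hne, hne⟩
  exact ⟨fun _ => 1, div_pos (norm33_pos h (by simp)) (norm222_pos h (by simp))⟩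

theorem exists_ratio_ge (hN : 256 ≤ N) :
    ∃ g : Triple N → ℝ, 1 / 1228800 * ((N : ℝ) ^ 2 * Real.log N ^ (-(5 / 2) : ℝ))
      ≤ (PairTensor.ofVector g).norm33 / (PairTensor.ofVector g).norm222 := by
  have hN' : (256 : ℝ) ≤ N := by exact_mod_cast hN
  have hL := two_le_log_of_le (N := N) (by omega)
  -- With `δ = 1/2` the requirement `64/δ² ≤ N` is the threshold `256`.
  have h1 := gaussianLaw_norm33_tail (N := N) (δ := 1 / 2) (by norm_num) (by norm_num)
    (by norm_num; linarith)
  have h2 := gaussianLaw_norm222_tail (N := N) (by omega)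
  set S₁ : Set (Triple N → ℝ) := {g | ¬ ((1 - 1 / 2) * (N : ℝ) ^ 3 ≤ (PairTensor.ofVector g).norm33 ∧
            (PairTensor.ofVector g).norm33 ≤ (1 + 1 / 2) * (N : ℝ) ^ 3)} with hS₁
  set S₂ : Set (Triple N → ℝ) := {g | ¬ ((PairTensor.ofVector g).norm222
      ≤ 614400 * N * Real.log N ^ (5 / 2 : ℝ))} with hS₂
  have hlt : (stdNormalLaw (Triple N)).real (S₁ ∪ S₂) < 1 := by
    have h3 : (stdNormalLaw (Triple N)).real (S₁ ∪ S₂)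
        ≤ Real.exp (-(1 * (1 / 2) ^ 2 * (N : ℝ) ^ 2)) + Real.exp (-(N : ℝ)) :=
      (measureReal_union_le _ _).trans (add_le_add h1 h2)
    have h4 : Real.exp (-(1 * (1 / 2) ^ 2 * (N : ℝ) ^ 2)) ≤ Real.exp (-(N : ℝ)) := by
      apply Real.exp_le_exp.2; nlinarith
    have h5 : 2 * Real.exp (-(N : ℝ)) < 1 := by
      have h6 : (2 : ℝ) < Real.exp N := by linarith [Real.add_one_le_exp (N : ℝ)]
      rw [Real.exp_neg, ← div_eq_mul_inv, div_lt_one (Real.exp_pos _)]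
      exact h6
    linarith
  have hex : ∃ g, g ∉ S₁ ∪ S₂ := by
    by_contra hcon
    push Not at hcon
    rw [Set.eq_univ_of_forall hcon, probReal_univ] at hlt
    exact lt_irrefl _ hlt
  obtain ⟨g, hg⟩ := hex
  simp only [hS₁, hS₂, Set.mem_union, not_or, Set.mem_ofPred_eq, not_not] at hg
  obtain ⟨⟨hg1, -⟩, hg2⟩ := hg
  have hpos : 0 < (PairTensor.ofVector g).norm33 := lt_of_lt_of_le (by positivity) hg1
  obtain ⟨p, q, hpq, hgpq⟩ := exists_allNe_of_norm33_pos hpos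
  have hpos2 := norm222_pos hpq hgpq
  refine ⟨g, ?_⟩
  rw [le_div_iff₀ hpos2]
  have hLp : (0 : ℝ) < Real.log N ^ (5 / 2 : ℝ) := Real.rpow_pos_of_pos (by linarith) _
  rw [Real.rpow_neg (by linarith)]
  calc _ ≤ 1 / 1228800 * ((N : ℝ) ^ 2 * (Real.log N ^ (5 / 2 : ℝ))⁻¹)
        * (614400 * N * Real.log N ^ (5 / 2 : ℝ)) := by gcongr
    _ = (1 - 1 / 2) * (N : ℝ) ^ 3 := by field_simp; norm_num
    _ ≤ _ := hg1

/-- Absorbs the finitely many small `N`, where the ratio is merely positive, into the constant. -/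
theorem exists_pos_forall_lt_mul_le {a b : ℕ → ℝ} {m : ℕ} (hb : ∀ N, 0 ≤ b N)
    (ha : ∀ N, m ≤ N → 0 < a N) (n : ℕ) :
    ∃ C : ℝ, 0 < C ∧ ∀ N, m ≤ N → N < n → C * b N ≤ a N := by
  induction n with
  | zero => exact ⟨1, one_pos, fun N _ h => absurd h (Nat.not_lt_zero N)⟩
  | succ n ih =>
    obtain ⟨C, hC, h⟩ := ih
    by_cases hn : m ≤ n
    · have hbn : 0 < b n + 1 := by linarith [hb n]
      refine ⟨min C (a n / (b n + 1)), lt_min hC (div_pos (ha n hn) hbn), fun N hN hlt => ?_⟩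
      rcases (Nat.lt_succ_iff.1 hlt).lt_or_eq with h' | rfl
      · exact (mul_le_mul_of_nonneg_right (min_le_left _ _) (hb N)).trans (h N hN h')
      · refine (mul_le_mul_of_nonneg_right (min_le_right _ _) (hb N)).trans ?_
        rw [div_mul_eq_mul_div, div_le_iff₀ hbn]
        have := ha N hN
        nlinarith
    · exact ⟨C, hC, fun N hN hlt => h N hN (by omega)⟩

theorem exists_ratio_constant : ∃ C : ℝ, 0 < C ∧ ∀ N : ℕ, 2 ≤ N → ∃ g : Triple N → ℝ,
    C * ((N : ℝ) ^ 2 * Real.log N ^ (-(5 / 2) : ℝ))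
      ≤ (PairTensor.ofVector g).norm33 / (PairTensor.ofVector g).norm222 := by
  have hb : ∀ N : ℕ, 0 ≤ (N : ℝ) ^ 2 * Real.log N ^ (-(5 / 2) : ℝ) := fun N =>
    mul_nonneg (by positivity) (Real.rpow_nonneg (Real.log_natCast_nonneg N) _)
  choose! g hg using fun (N : ℕ) (hN : 2 ≤ N) => exists_ratio_pos hN
  obtain ⟨C, hC, h⟩ := exists_pos_forall_lt_mul_le hb hg 256
  refine ⟨min C (1 / 1228800), lt_min hC (by norm_num), fun N hN => ?_⟩
  rcases lt_or_ge N 256 with hlt | hge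
  · exact ⟨g N, (mul_le_mul_of_nonneg_right (min_le_left _ _) (hb N)).trans (h N hN hlt)⟩
  · obtain ⟨g', hg'⟩ := exists_ratio_ge hge
    exact ⟨g', (mul_le_mul_of_nonneg_right (min_le_right _ _) (hb N)).trans hg'⟩

end Positivity

theorem mainTheorem2 :
    (∃ C : ℝ, 0 < C ∧ ∀ N : ℕ, 2 ≤ N →
      ∃ T : PairTensor N, (∃ g : Triple N → ℝ, T = PairTensor.ofVector g) ∧
        T.norm33 / T.norm222 ≥ C * (N : ℝ) ^ 2 * Real.log N ^ (-(5 / 2) : ℝ)) ∧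
    (∃ c : ℝ, 0 < c ∧ ∀ δ : ℝ, 0 < δ → δ < 1 → ∃ N₀ : ℕ, ∀ N : ℕ, N₀ ≤ N →
      (PairTensor.gaussianLaw N).real
          {g | ¬ ((1 - δ) * (N : ℝ) ^ 3 ≤ (PairTensor.ofVector g).norm33 ∧
            (PairTensor.ofVector g).norm33 ≤ (1 + δ) * (N : ℝ) ^ 3)}
        ≤ Real.exp (-(c * δ ^ 2 * (N : ℝ) ^ 2))) ∧
    (∃ d D : ℝ, 0 < d ∧ 0 < D ∧ ∃ N₀ : ℕ, ∀ N : ℕ, N₀ ≤ N →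
      (PairTensor.gaussianLaw N).real
          {g | ¬ ((PairTensor.ofVector g).norm222 ≤ D * (N : ℝ) * Real.log N ^ (5 / 2 : ℝ))}
        ≤ Real.exp (-(d * (N : ℝ)))) := by
  refine ⟨?_, ⟨1, one_pos, fun δ hδ hδ1 => ⟨⌈64 / δ ^ 2⌉₊, fun N hN => ?_⟩⟩,
    ⟨1, 614400, one_pos, by norm_num, 30, fun N hN => ?_⟩⟩
  · obtain ⟨C, hC, h⟩ := exists_ratio_constant
    refine ⟨C, hC, fun N hN => ?_⟩
    obtain ⟨g, hg⟩ := h N hN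
    refine ⟨PairTensor.ofVector g, ⟨g, rfl⟩, ?_⟩
    rw [ge_iff_le, mul_assoc]
    exact hg
  · exact gaussianLaw_norm33_tail hδ hδ1 (Nat.ceil_le.1 hN)
  · rw [one_mul]
    exact gaussianLaw_norm222_tail hN
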